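/- Let $n\ge 4$. The Young wall pattern of type $D_n$ consists of columns $i=0,1,2,\dots$ (from left to right) with positions at levels $y=0,1,2,\dots$. A position whose level is divisible by $n-2$ is divided into two triangular half-blocks, an upper and a lower one; every other position carries one full block. Going up a column, the labels are $0/1,\,2,\,3,\dots,n-2,\,(n-1)/n,\,n-2,\dots,3,\,2$, repeated with period $2n-4$; the divided positions carry the two labels $0,1$, respectively $n-1,n$, where the smaller label is on the upper half-block if $i$ is even and on the lower one if $i$ is odd. The lower half-blocks of level $0$ are grey, all other blocks are white. A *Young wall* of type $D_n$ is a subset $Y$ of the pattern such that: (1) $Y$ contains all grey half-blocks and finitely many white blocks; (2) no block of $Y$ lies on top of a missing block or half-block; (3) if a block of column $i+1$ is in $Y$, then so is the block of column $i$ at the same level (for half-blocks: the half-block of the same orientation); (4) no two full columns have the same height, where a column is full if at its top there is a full block or both half-blocks. Let $\mathcal Z_\Delta$ be the set of Young walls of type $D_n$, let $\mathrm{wt}_j(Y)$ be the number of white blocks and half-blocks of label $j$ in $Y$, and let $$Z_\Delta(q_0,\dots,q_n)=\sum_{Y\in\mathcal Z_\Delta}\prod_{j=0}^n q_j^{\mathrm{wt}_j(Y)}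 .$$ A missing block $b\notin Y$ is *salient* if $Y\cup\{b\}$ is again a Young wall. A missing half-block at column $i$, level $y$ is *directly supported* if the other half-block at this position is missing too, every block at column $i$, level $y-1$ is in $Y$ (no condition if $y=0$), $i\ge1$, and some block at column $i-1$, level $y+1$ is missing. A Young wall $Y$ is *$0$-generated* if * for every salient half-block of label $n-1$ or $n$, both half-blocks at its position are salient and directly supported; * no salient block of $Y$ has label in $\{1,\dots,n-2\}$. It is *distinguished* if moreover * every maximal series of consecutive columns of equal height which end in a single half-block of label $n-1$ or $n$ is longer than $n-1$. Let $\mathcal Z_\Delta^0$ be the set of distinguished $0$-generated Young walls. **Theorem.** For every $k\ge0$ there are only finitely many $Y\in\mathcal Z_\Delta$ with $\mathrm{wt}_0(Y)=k$. If $\xi\in\mathbb C$ is a primitive $(2n-1)$-st root of unity, then $$\sum_{Y\in\mathcal Z_\Delta^0}q^{\mathrm{wt}_0(Y)}=Z_\Delta(q_0,\dots,q_n)\Big|_{q_0=\xi^2q,\ q_1=\dots=q_n=\xi}$$ as formal power series in $q$. -/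

import Mathlib

namespace DWall

open scoped PowerSeries.WithPiTopology

/-- Shapes of the blocks of the pattern: full (square) blocks, and the upper and the lower
triangular half-blocks into which a divided square is cut. -/
inductive Shape where
  | square
  | upper
  | lower

/-- A block or half-block, in column `col` (columns are counted from the left, starting at `0`)
and at vertical position `lev` in its column (counted from the bottom, starting at `0`). -/
structure Block where
  col : ℕ
  lev : ℕ
  shape : Shape

/-- The other half of a divided square. -/
def Shape.flip : Shape → Shape
  | .square => .square
  | .upper => .lower
  | .lower => .upper

/-- The complementary half-block, at the same position. -/
def Block.flip (b : Block) : Block := ⟨b.col, b.lev, b.shape.flip⟩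

/-- The Young wall pattern of type `D_n`: the squares at the levels divisible by `n - 2` are divided
into two half-blocks, all other squares are full blocks. -/
def pattern (n : ℕ) : Set Block := {b | b.shape = Shape.square ↔ ¬ (n - 2) ∣ b.lev}

/-- The grey half-blocks, which are the lower halves in the bottom level. All other blocks and
half-blocks of the pattern are white. -/
def Block.IsGrey (b : Block) : Prop := b.lev = 0 ∧ b.shape = Shape.lower

/-- `0` for upper half-blocks in even columns and lower half-blocks in odd columns, `1` for the
other half-blocks: the two labels at the divided positions alternate from column to column. -/
def Block.halfIndex (b : Block) : ℕ :=
  match b.shape with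
  | .upper => b.col % 2
  | _ => (b.col + 1) % 2

/-- The label of a block. Going up a column, the labels are
`0/1, 2, 3, …, n - 2, (n-1)/n, n - 2, …, 3, 2`, repeated with period `2 n - 4`. -/
def label (n : ℕ) (b : Block) : ℕ :=
  if b.lev % (2 * n - 4) = 0 then b.halfIndex
  else if b.lev % (2 * n - 4) = n - 2 then n - 1 + b.halfIndex
  else if b.lev % (2 * n - 4) < n - 2 then b.lev % (2 * n - 4) + 1
  else 2 * n - 3 - b.lev % (2 * n - 4)

/-- The `i`-th column of `Y` is full, with its topmost square at level `y`: either a full block or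
both half-blocks are present there, and there is nothing above. -/
def IsFullColumn (n : ℕ) (Y : Set Block) (i y : ℕ) : Prop :=
  (∀ b ∈ pattern n, b.col = i → b.lev = y → b ∈ Y) ∧ ∀ b ∈ Y, b.col = i → b.lev ≤ y

/-- The rules for (proper) Young walls of type `D_n`. -/
structure IsYoungWall (n : ℕ) (Y : Set Block) : Prop where
  subset_pattern : Y ⊆ pattern n
  /-- all grey half-blocks are in `Y` -/
  grey_mem : ∀ b ∈ pattern n, b.IsGrey → b ∈ Y
  /-- only finitely many white blocks are in `Y` -/
  finite_white : {b ∈ Y | ¬ b.IsGrey}.Finite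
  /-- no block is placed on top of a missing block or half-block -/
  column : ∀ b ∈ Y, ∀ c ∈ pattern n, c.col = b.col → c.lev + 1 = b.lev → c ∈ Y
  /-- there is no free position to the left of a block; for half-blocks, only the half-block of the
  same orientation has to be present -/
  left : ∀ (i y : ℕ) (s : Shape), (⟨i + 1, y, s⟩ : Block) ∈ Y → (⟨i, y, s⟩ : Block) ∈ Y
  /-- no two full columns have the same height -/
  proper : ∀ i j y, IsFullColumn n Y i y → IsFullColumn n Y j y → i = j

/-- The set of all Young walls of type `D_n`. -/
def YoungWall (n : ℕ) : Type := {Y : Set Block // IsYoungWall n Y}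

/-- The `j`-weight of a set of blocks: its number of white blocks and half-blocks of label `j`. -/
noncomputable def wt (n : ℕ) (Y : Set Block) (j : ℕ) : ℕ :=
  {b ∈ Y | ¬ b.IsGrey ∧ label n b = j}.ncard

/-- The multi-weight `(wt_0(Y), …, wt_n(Y))`. -/
noncomputable def wtVec (n : ℕ) (Y : Set Block) : Fin (n + 1) →₀ ℕ :=
  Finsupp.equivFunOnFinite.symm fun j => wt n Y j

/-- A salient block of `Y`: a missing block which can be added to `Y` without violating the rules of
Young walls. (Whether this is possible depends only on the columns to the left of the block and on
the blocks below it in its own column.) -/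
def IsSalient (n : ℕ) (Y : Set Block) (b : Block) : Prop :=
  b ∈ pattern n ∧ b ∉ Y ∧ IsYoungWall n (insert b Y)

/-- A missing half-block is directly supported if the complementary half-block is missing too, the
square under their common position is in `Y`, and the full block `c` which is the next one to the
left of and above this position is missing. In the sheared form of the pattern, in which the columns
become the rows and the `i`-th one is shifted by `i`, the block `c` is the one immediately below
the divided position, and the square under it becomes its left neighbour. -/
def IsDirectlySupported (n : ℕ) (Y : Set Block) (b : Block) : Prop :=
  b ∉ Y ∧ b.flip ∉ Y ∧
    (∀ c ∈ pattern n, c.col = b.col → c.lev + 1 = b.lev → c ∈ Y) ∧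
    ∃ c ∈ pattern n, c ∉ Y ∧ c.col + 1 = b.col ∧ c.lev = b.lev + 1

/-- `0`-generated Young walls: each salient block of label `n - 1` or `n` is part of a directly
supported pair of salient half-blocks, and there is no salient block of label `1, …, n - 2`. -/
def IsZeroGenerated (n : ℕ) (Y : Set Block) : Prop :=
  (∀ b, IsSalient n Y b → label n b = n - 1 ∨ label n b = n →
    IsSalient n Y b.flip ∧ IsDirectlySupported n Y b ∧ IsDirectlySupported n Y b.flip) ∧
  ∀ b, IsSalient n Y b → label n b ∉ Set.Icc 1 (n - 2)

/-- The `i`-th column of `Y` ends in a single half-block at level `y`. -/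
def EndsInHalf (Y : Set Block) (i y : ℕ) : Prop :=
  ∃ b ∈ Y, b.col = i ∧ b.lev = y ∧ b.shape ≠ Shape.square ∧ b.flip ∉ Y

/-- Distinguished `0`-generated Young walls: every series of columns of equal height which end in a
single half-block of label `n - 1` or `n` is longer than `n - 1`. (Columns of equal height are
automatically consecutive, and the labels `n - 1`, `n` occur at the levels `n - 2` modulo
`2 n - 4`.) -/
def IsDistinguished (n : ℕ) (Y : Set Block) : Prop :=
  IsZeroGenerated n Y ∧
  ∀ y, y % (2 * n - 4) = n - 2 → (∃ i, EndsInHalf Y i y) → n - 1 < {i | EndsInHalf Y i y}.ncard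

/-- The multi-weight generating series of all Young walls of type `D_n`. -/
noncomputable def wallSeries (n : ℕ) : MvPowerSeries (Fin (n + 1)) ℂ :=
  fun v => (Nat.card {Y : YoungWall n // wtVec n Y.1 = v} : ℂ)

/-- The generating series of the distinguished `0`-generated Young walls by their `0`-weight. -/
noncomputable def distinguishedSeries (n : ℕ) : PowerSeries ℂ :=
  PowerSeries.mk fun k =>
    (Nat.card {Y : YoungWall n // IsDistinguished n Y.1 ∧ wt n Y.1 0 = k} : ℂ)

/-- `G` is the result of the substitution `q_i = s_i` in the formal power series `F`, summed
coefficientwise. -/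
def HasSpecialization {σ : Type} (F : MvPowerSeries σ ℂ) (s : σ → PowerSeries ℂ)
    (G : PowerSeries ℂ) : Prop :=
  HasSum (fun v : σ →₀ ℕ => PowerSeries.C (MvPowerSeries.coeff v F) * v.prod fun i e => s i ^ e) G

end DWall

/-!
A Young wall is determined by the levels at which its full columns end and, at each divided level,
by the signed number of columns that end there in a single half-block. The signed number at a level
divisible by `2n - 4` splits further into two bits and a number of bosons. Grouped by periods of the
pattern, these data become a sequence of layers: a set `F` of fermions among `0, …, 2n - 3`, a
charge `D ∈ ℤ` and a number `j` of bosons. In twice the `0`-weight, layer `a` contributes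
`(2a + 1)(|F| + |D|) + 4(a + 1)j`, and the substitution counts it with a product over `F` of
distinct `(2n - 1)`-st roots of unity other than `1`.

For fixed `N = |F| + |D|` and `j`, these products add up to the coefficient of `X ^ N` in
`(1 + X ^ (2n - 1)) / (1 + X) * (1 + X) / (1 - X)`, which is `1` for `N ≤ 2n - 2` and `2` otherwise.
A wall is distinguished and `0`-generated if and only if, in each layer, `F` is a final segment and
`D ≠ 0` only if `|F| = n - 1 < |D|`; there are again `1` or `2` such layers with given `N` and `j`.
-/

namespace DWall

open Finset

/-! ### Profiles of Young walls -/

theorem mem_iff_lt_ncard {S : Set ℕ} (hS : S.Finite) (hlower : IsLowerSet S) (i : ℕ) :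
    i ∈ S ↔ i < S.ncard := by
  obtain rfl | ⟨m, rfl⟩ := hlower.eq_univ_or_Iio
  · exact absurd hS Set.infinite_univ
  · rw [← Finset.coe_Iio, Set.ncard_coe_finset, Nat.card_Iio, Finset.coe_Iio, Set.mem_Iio]

theorem sum_filter_le_eq_add {M : Type*} [AddCommMonoid M] (s : Finset ℕ) (f : ℕ → M) (y : ℕ) :
    ∑ z ∈ s with y ≤ z, f z = (if y ∈ s then f y else 0) + ∑ z ∈ s with y + 1 ≤ z, f z := by
  rw [← sum_ite_eq' s y f, sum_filter, sum_filter, ← sum_add_distrib]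
  refine sum_congr rfl fun z _ => ?_
  rcases lt_trichotomy y z with h | rfl | h
  · simp [h.le, h.ne', Nat.succ_le_of_lt h]
  · simp
  · simp [h.ne, not_le_of_gt h, show ¬ y + 1 ≤ z by omega]

/-- The combinatorial type of a Young wall, given by the ends of its columns: `full` is the set of
levels at which a full column ends, and `|half y|` columns end in a single half-block at level
`y`. These columns are consecutive and their half-blocks have the same orientation, hence their
labels alternate; `half y` is positive if the smaller label comes first. -/
@[ext] structure Profile (n : ℕ) where
  full : Finset ℕ
  half : ℕ →₀ ℤ
  half_zero : half 0 = 0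
  half_of_not_dvd : ∀ y, ¬ (n - 2) ∣ y → half y = 0

namespace Profile

variable {n : ℕ} (P : Profile n)

/-- The number of columns that end at level `y` or above. -/
def top (y : ℕ) : ℕ :=
  ∑ z ∈ P.full with y ≤ z, 1 + ∑ z ∈ P.half.support with y ≤ z, (P.half z).natAbs

/-- The number of columns that contain everything at level `y`. -/
def low (y : ℕ) : ℕ := (if y ∈ P.full then 1 else 0) + P.top (y + 1)

theorem top_eq (y : ℕ) : P.top y = (P.half y).natAbs + P.low y := by
  have hhalf : (if y ∈ P.half.support then (P.half y).natAbs else 0) = (P.half y).natAbs := by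
    simp +contextual
  rw [top, sum_filter_le_eq_add, sum_filter_le_eq_add P.half.support, hhalf, low, top]
  ring

theorem low_le_top (y : ℕ) : P.low y ≤ P.top y := by
  rw [top_eq]; omega

theorem top_succ_le_low (y : ℕ) : P.top (y + 1) ≤ P.low y := by
  unfold low; omega

theorem top_antitone : Antitone P.top :=
  antitone_nat_of_succ_le fun y => (P.top_succ_le_low y).trans (P.low_le_top y)

variable {P} in
theorem top_of_half_eq_zero {y : ℕ} (h : P.half y = 0) : P.top y = P.low y := by
  simp [top_eq, h]

/-- All columns end below level `H`. -/
def IsBound (H : ℕ) : Prop := ∀ y, H ≤ y → y ∉ P.full ∧ P.half y = 0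

variable {P} in
theorem IsBound.mono {H K : ℕ} (hH : P.IsBound H) (h : H ≤ K) : P.IsBound K :=
  fun y hy => hH y (h.trans hy)

variable {P} in
theorem IsBound.top_eq_zero {H : ℕ} (h : P.IsBound H) : P.top H = 0 := by
  rw [top, filter_false_of_mem fun z hz hHz => (h z hHz).1 hz,
    filter_false_of_mem fun z hz hHz => Finsupp.mem_support_iff.1 hz (h z hHz).2]
  rfl

theorem exists_isBound : ∃ H, P.IsBound H := by
  obtain ⟨H, hH⟩ := (P.full ∪ P.half.support).exists_nat_subset_range
  refine ⟨H, fun y hy => ?_⟩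
  have hnot : y ∉ P.full ∪ P.half.support := fun h => by simpa [hy.not_gt] using hH h
  simpa [not_or] using hnot

/-- The number of upper minus the number of lower half-blocks on which columns end at level `y`. -/
def tilt (y : ℕ) : ℤ := (-1) ^ P.low y * P.half y

theorem natAbs_tilt (y : ℕ) : (P.tilt y).natAbs = (P.half y).natAbs := by
  simp [tilt, Int.natAbs_mul, Int.natAbs_pow]

theorem half_eq_tilt (y : ℕ) : P.half y = (-1) ^ P.low y * P.tilt y := by
  rw [tilt, ← mul_assoc, ← mul_pow]
  simp

variable {P} in
theorem tilt_of_even {y : ℕ} (h : P.low y % 2 = 0) : P.tilt y = P.half y := by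
  rw [tilt, (Nat.even_iff.2 h).neg_one_pow, one_mul]

variable {P} in
theorem tilt_of_odd {y : ℕ} (h : P.low y % 2 = 1) : P.tilt y = -P.half y := by
  rw [tilt, (Nat.odd_iff.2 h).neg_one_pow, neg_one_mul]

end Profile

/-- The number of half-blocks of shape `s` in a row of `|z|` half-blocks which are upper ones for
positive `z` and lower ones for negative `z`. -/
def Shape.part : Shape → ℤ → ℕ
  | .square, _ => 0
  | .upper, z => z.toNat
  | .lower, z => (-z).toNat

theorem Shape.part_le (s : Shape) (z : ℤ) : s.part z ≤ z.natAbs := by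
  cases s <;> simp only [part] <;> omega

namespace Profile

variable {n : ℕ} (P : Profile n)

/-- The length of the row of blocks of shape `s` at level `y`. -/
def row (y : ℕ) (s : Shape) : ℕ := P.low y + s.part (P.tilt y)

theorem low_le_row (y : ℕ) (s : Shape) : P.low y ≤ P.row y s := Nat.le_add_right _ _

theorem row_le_top (y : ℕ) (s : Shape) : P.row y s ≤ P.top y := by
  rw [top_eq, row, ← natAbs_tilt, add_comm]
  gcongr
  exact s.part_le _

theorem row_square (y : ℕ) : P.row y .square = P.low y := rfl

variable {P} in
theorem row_of_half_eq_zero {y : ℕ} (h : P.half y = 0) (s : Shape) : P.row y s = P.low y := by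
  cases s <;> simp [row, tilt, h, Shape.part]

/-- The Young wall of type `D_n` with the given ends of columns. -/
def wall : Set Block := {b | b ∈ pattern n ∧ (b.IsGrey ∨ b.col < P.row b.lev b.shape)}

end Profile

section Pattern

variable {n i y : ℕ}

theorem mem_pattern_square : (⟨i, y, .square⟩ : Block) ∈ pattern n ↔ ¬ (n - 2) ∣ y := by
  simp [pattern]

theorem mem_pattern_of_ne_square {s : Shape} (hs : s ≠ .square) :
    (⟨i, y, s⟩ : Block) ∈ pattern n ↔ (n - 2) ∣ y := by
  simp [pattern, hs]

theorem mem_pattern_upper : (⟨i, y, .upper⟩ : Block) ∈ pattern n ↔ (n - 2) ∣ y :=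
  mem_pattern_of_ne_square (by simp)

theorem mem_pattern_lower : (⟨i, y, .lower⟩ : Block) ∈ pattern n ↔ (n - 2) ∣ y :=
  mem_pattern_of_ne_square (by simp)

theorem finite_of_col_lt_of_lev_lt {S : Set Block} {B H : ℕ}
    (h : ∀ b ∈ S, b.col < B ∧ b.lev < H) : S.Finite := by
  have hT : ({.square, .upper, .lower} : Set Shape).Finite := by simp
  refine (((Set.finite_Iio B).prod ((Set.finite_Iio H).prod hT)).image
    (fun x => (⟨x.1, x.2.1, x.2.2⟩ : Block))).subset ?_
  rintro ⟨i, y, s⟩ hb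
  refine ⟨(i, y, s), ⟨(h _ hb).1, (h _ hb).2, ?_⟩, rfl⟩
  cases s <;> simp

end Pattern

namespace Profile

variable {n : ℕ} {P : Profile n} {i y : ℕ} {s : Shape}

theorem mem_wall : (⟨i, y, s⟩ : Block) ∈ P.wall ↔
    (⟨i, y, s⟩ : Block) ∈ pattern n ∧ ((y = 0 ∧ s = .lower) ∨ i < P.row y s) := Iff.rfl

theorem exists_mem_wall (hi : i < P.top y) : ∃ s, (⟨i, y, s⟩ : Block) ∈ P.wall := by
  by_cases hy : (n - 2) ∣ y
  · rw [top_eq, ← natAbs_tilt] at hi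
    by_cases hs : 0 ≤ P.tilt y
    · refine ⟨.upper, mem_wall.2 ⟨mem_pattern_upper.2 hy, Or.inr ?_⟩⟩
      simp only [row, Shape.part]; omega
    · refine ⟨.lower, mem_wall.2 ⟨mem_pattern_lower.2 hy, Or.inr ?_⟩⟩
      simp only [row, Shape.part]; omega
  · refine ⟨.square, mem_wall.2 ⟨mem_pattern_square.2 hy, Or.inr ?_⟩⟩
    rwa [row_square, ← top_of_half_eq_zero (P.half_of_not_dvd y hy)]

theorem lt_top_of_mem_wall (h : (⟨i, y, s⟩ : Block) ∈ P.wall)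
    (hg : ¬ (y = 0 ∧ s = .lower)) : i < P.top y :=
  ((mem_wall.1 h).2.resolve_left hg).trans_le (P.row_le_top y s)

theorem forall_mem_wall_iff :
    (∀ b ∈ pattern n, b.col = i → b.lev = y → b ∈ P.wall) ↔ i < P.low y := by
  constructor
  · intro h
    by_cases hy : (n - 2) ∣ y
    · have hupper := (h ⟨i, y, .upper⟩ (mem_pattern_upper.2 hy) rfl rfl).2
      have hlower := (h ⟨i, y, .lower⟩ (mem_pattern_lower.2 hy) rfl rfl).2
      simp only [Block.IsGrey, reduceCtorEq, and_false, false_or, and_true] at hupper hlower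
      obtain rfl | h0 := eq_or_ne y 0
      · rwa [row_of_half_eq_zero P.half_zero] at hupper
      · have hlower := hlower.resolve_left h0
        simp only [row, Shape.part] at hupper hlower
        omega
    · simpa [Block.IsGrey, row_square] using (h ⟨i, y, .square⟩ (mem_pattern_square.2 hy) rfl rfl).2
  · rintro h ⟨j, z, s⟩ hb rfl rfl
    exact mem_wall.2 ⟨hb, Or.inr (h.trans_le (P.low_le_row _ _))⟩

theorem isFullColumn_wall_iff :
    IsFullColumn n P.wall i y ↔ y ∈ P.full ∧ i = P.top (y + 1) := by
  unfold IsFullColumn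
  rw [forall_mem_wall_iff]
  constructor
  · rintro ⟨hlow, hmax⟩
    have htop : ¬ i < P.top (y + 1) := by
      intro h
      obtain ⟨s, hs⟩ := exists_mem_wall h
      simpa using hmax _ hs rfl
    unfold low at hlow
    split_ifs at hlow with h
    · exact ⟨h, by omega⟩
    · omega
  · rintro ⟨hy, rfl⟩
    refine ⟨by simp [low, hy], ?_⟩
    rintro ⟨j, z, s⟩ hb rfl
    by_contra hz
    have hz : y < z := by simpa using hz
    have hlt := lt_top_of_mem_wall hb (by omega)
    have hle := P.top_antitone (show y + 1 ≤ z from hz)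
    omega

theorem isYoungWall_wall (P : Profile n) : IsYoungWall n P.wall where
  subset_pattern := fun _ hb => hb.1
  grey_mem := fun _ hb hg => ⟨hb, Or.inl hg⟩
  finite_white := by
    obtain ⟨H, hH⟩ := P.exists_isBound
    refine finite_of_col_lt_of_lev_lt (B := P.top 0) (H := H) ?_
    rintro ⟨i, y, s⟩ ⟨hb, hg⟩
    have hi := lt_top_of_mem_wall hb hg
    refine ⟨hi.trans_le (P.top_antitone (Nat.zero_le _)), ?_⟩
    by_contra hy
    rw [(hH.mono (not_lt.1 hy)).top_eq_zero] at hi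
    exact Nat.not_lt_zero _ hi
  column := by
    rintro ⟨i, y, s⟩ hb ⟨j, z, s'⟩ hc rfl rfl
    have hj := lt_top_of_mem_wall hb fun h => Nat.succ_ne_zero z h.1
    exact mem_wall.2 ⟨hc, Or.inr <| hj.trans_le <|
      (P.top_succ_le_low z).trans (P.low_le_row z s')⟩
  left := by
    intro i y s h
    rw [mem_wall] at h ⊢
    exact ⟨h.1, h.2.imp_right fun h => by omega⟩
  proper := by
    intro i j y hi hj
    rw [isFullColumn_wall_iff] at hi hj
    rw [hi.2, hj.2]

section Injective

variable {P Q : Profile n}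

theorem row_eq_of_wall_eq (h : P.wall = Q.wall) (hp : (⟨0, y, s⟩ : Block) ∈ pattern n)
    (hg : ¬ (y = 0 ∧ s = .lower)) : P.row y s = Q.row y s := by
  refine eq_of_forall_lt_iff fun i => ?_
  have hmem := Set.ext_iff.1 h ⟨i, y, s⟩
  have hp' : (⟨i, y, s⟩ : Block) ∈ pattern n := hp
  simpa [mem_wall, hp', hg] using hmem

theorem low_tilt_eq_of_wall_eq (h : P.wall = Q.wall) (y : ℕ) :
    P.low y = Q.low y ∧ P.tilt y = Q.tilt y := by
  by_cases hy : (n - 2) ∣ y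
  · have hupper := row_eq_of_wall_eq h (mem_pattern_upper.2 hy) (by simp)
    obtain rfl | h0 := eq_or_ne y 0
    · rw [row_of_half_eq_zero P.half_zero, row_of_half_eq_zero Q.half_zero] at hupper
      simp [hupper, tilt, P.half_zero, Q.half_zero]
    · have hlower := row_eq_of_wall_eq h (mem_pattern_lower.2 hy) (by simp [h0])
      simp only [row, Shape.part] at hupper hlower
      omega
  · have hsquare := row_eq_of_wall_eq h (mem_pattern_square.2 hy) (by simp)
    rw [row_square, row_square] at hsquare
    simp [hsquare, tilt, P.half_of_not_dvd y hy, Q.half_of_not_dvd y hy]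

theorem wall_injective : Function.Injective (wall (n := n)) := by
  intro P Q h
  have hhalf : ∀ y, P.half y = Q.half y := fun y => by
    rw [half_eq_tilt, half_eq_tilt, (low_tilt_eq_of_wall_eq h y).1, (low_tilt_eq_of_wall_eq h y).2]
  refine Profile.ext ?_ (Finsupp.ext hhalf)
  ext y
  have hlow := (low_tilt_eq_of_wall_eq h y).1
  have htop : P.top (y + 1) = Q.top (y + 1) := by
    rw [top_eq, top_eq, hhalf, (low_tilt_eq_of_wall_eq h _).1]
  unfold low at hlow
  by_cases hP : y ∈ P.full <;> by_cases hQ : y ∈ Q.full <;> simp [hP, hQ, htop] at hlow ⊢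

end Injective

end Profile

/-- The number of white blocks of shape `s` at level `y`. -/
noncomputable def rowLength (Y : Set Block) (y : ℕ) (s : Shape) : ℕ :=
  {i | (⟨i, y, s⟩ : Block) ∈ Y ∧ ¬ (y = 0 ∧ s = .lower)}.ncard

/-- The number of columns with some white block at level `y`. -/
noncomputable def maxRow (Y : Set Block) (y : ℕ) : ℕ :=
  max (rowLength Y y .square) (max (rowLength Y y .upper) (rowLength Y y .lower))

/-- The number of columns with all blocks at level `y`; at level `0` the lower half-blocks are grey
and impose no condition. -/
noncomputable def minRow (Y : Set Block) (y : ℕ) : ℕ :=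
  if y = 0 then rowLength Y y .upper
  else max (rowLength Y y .square) (min (rowLength Y y .upper) (rowLength Y y .lower))

/-- The number of upper minus the number of lower half-blocks at a positive level `y`. -/
noncomputable def rowTilt (Y : Set Block) (y : ℕ) : ℤ :=
  if y = 0 then 0 else (rowLength Y y .upper : ℤ) - rowLength Y y .lower

namespace IsYoungWall

variable {n : ℕ} {Y : Set Block} {i y : ℕ} {s : Shape}

theorem mem_iff (hY : IsYoungWall n Y) (hg : ¬ (y = 0 ∧ s = .lower)) :
    (⟨i, y, s⟩ : Block) ∈ Y ↔ i < rowLength Y y s := by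
  rw [rowLength, ← mem_iff_lt_ncard]
  · simp [hg]
  · refine (hY.finite_white.image Block.col).subset ?_
    rintro i ⟨hi, h⟩
    exact ⟨⟨i, y, s⟩, ⟨hi, h⟩, rfl⟩
  · intro i j hji hi
    exact ⟨Nat.decreasingInduction' (fun k _ _ hk => hY.left k y s hk) hji hi.1, hi.2⟩

theorem rowLength_eq_zero (hY : IsYoungWall n Y) (h : (⟨0, y, s⟩ : Block) ∉ pattern n) :
    rowLength Y y s = 0 := by
  have hempty : {i | (⟨i, y, s⟩ : Block) ∈ Y ∧ ¬ (y = 0 ∧ s = .lower)} = ∅ :=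
    Set.eq_empty_of_forall_notMem fun i hi =>
      have hp := hY.subset_pattern hi.1
      h hp
  rw [rowLength, hempty, Set.ncard_empty]

theorem rowLength_square (hY : IsYoungWall n Y) (hy : (n - 2) ∣ y) :
    rowLength Y y .square = 0 :=
  hY.rowLength_eq_zero (by simp [mem_pattern_square, hy])

theorem rowLength_upper (hY : IsYoungWall n Y) (hy : ¬ (n - 2) ∣ y) :
    rowLength Y y .upper = 0 :=
  hY.rowLength_eq_zero (by simp [mem_pattern_upper, hy])

theorem rowLength_lower (hY : IsYoungWall n Y) (hy : ¬ (n - 2) ∣ y) :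
    rowLength Y y .lower = 0 :=
  hY.rowLength_eq_zero (by simp [mem_pattern_lower, hy])

theorem exists_bound (hY : IsYoungWall n Y) : ∃ H, ∀ y, H ≤ y → ∀ s, rowLength Y y s = 0 := by
  obtain ⟨B, hB⟩ := (hY.finite_white.image Block.lev).bddAbove
  refine ⟨B + 1, fun y hy s => ?_⟩
  by_contra h
  have hg : ¬ (y = 0 ∧ s = .lower) := by omega
  have hmem := (hY.mem_iff (i := 0) hg).2 (Nat.pos_of_ne_zero h)
  exact absurd (hB ⟨⟨0, y, s⟩, ⟨hmem, hg⟩, rfl⟩) (not_le.2 hy)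

theorem rowTilt_of_not_dvd (hY : IsYoungWall n Y) (hy : ¬ (n - 2) ∣ y) : rowTilt Y y = 0 := by
  simp [rowTilt, hY.rowLength_upper hy, hY.rowLength_lower hy]

theorem maxRow_eq (hY : IsYoungWall n Y) (y : ℕ) :
    maxRow Y y = (rowTilt Y y).natAbs + minRow Y y := by
  by_cases hy : (n - 2) ∣ y
  · unfold maxRow minRow rowTilt
    rw [hY.rowLength_square hy]
    split_ifs with h0
    · simp [h0, rowLength]
    · omega
  · have h0 : y ≠ 0 := by rintro rfl; exact hy (dvd_zero _)
    simp [maxRow, minRow, hY.rowTilt_of_not_dvd hy, h0, hY.rowLength_upper hy,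
      hY.rowLength_lower hy]

theorem lt_minRow (hY : IsYoungWall n Y) :
    i < minRow Y y ↔ ∀ b ∈ pattern n, b.col = i → b.lev = y → b ∈ Y := by
  unfold minRow
  by_cases hy : (n - 2) ∣ y
  · have hhalves : (∀ b ∈ pattern n, b.col = i → b.lev = y → b ∈ Y) ↔
        (⟨i, y, .upper⟩ : Block) ∈ Y ∧ (⟨i, y, .lower⟩ : Block) ∈ Y := by
      refine ⟨fun h => ⟨h _ (mem_pattern_upper.2 hy) rfl rfl,
        h _ (mem_pattern_lower.2 hy) rfl rfl⟩, ?_⟩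
      rintro ⟨hupper, hlower⟩ ⟨j, z, s⟩ hb rfl rfl
      cases s
      exacts [absurd hy (mem_pattern_square.1 hb), hupper, hlower]
    rw [hhalves, hY.mem_iff (by simp)]
    split_ifs with h0
    · subst h0
      simp [hY.grey_mem _ (mem_pattern_lower.2 hy) ⟨rfl, rfl⟩]
    · rw [hY.mem_iff (by simp [h0]), hY.rowLength_square hy]
      omega
  · have h0 : y ≠ 0 := by rintro rfl; exact hy (dvd_zero _)
    rw [if_neg h0, hY.rowLength_upper hy, Nat.zero_min, Nat.max_zero, ← hY.mem_iff (by simp)]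
    refine ⟨?_, fun h => h _ (mem_pattern_square.2 hy) rfl rfl⟩
    rintro h ⟨j, z, s⟩ hb rfl rfl
    cases s
    exacts [h, absurd (mem_pattern_upper.1 hb) hy, absurd (mem_pattern_lower.1 hb) hy]

theorem lt_maxRow (hY : IsYoungWall n Y) (hy : y ≠ 0) :
    i < maxRow Y y ↔ ∃ s, (⟨i, y, s⟩ : Block) ∈ Y := by
  rw [maxRow, lt_max_iff, lt_max_iff, ← hY.mem_iff (by simp), ← hY.mem_iff (by simp),
    ← hY.mem_iff (by simp [hy])]
  constructor
  · rintro (h | h | h) <;> exact ⟨_, h⟩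
  · rintro ⟨_ | _ | _, h⟩
    exacts [Or.inl h, Or.inr (Or.inl h), Or.inr (Or.inr h)]

theorem maxRow_succ_le (hY : IsYoungWall n Y) (y : ℕ) : maxRow Y (y + 1) ≤ minRow Y y := by
  by_contra! h
  obtain ⟨s, hs⟩ := (hY.lt_maxRow (Nat.succ_ne_zero y)).1 h
  refine lt_irrefl (minRow Y y) (hY.lt_minRow.2 fun c hc hcol hlev => ?_)
  exact hY.column _ hs c hc hcol (by rw [hlev])

theorem maxRow_antitone (hY : IsYoungWall n Y) : Antitone (maxRow Y) :=
  antitone_nat_of_succ_le fun y => (hY.maxRow_succ_le y).trans (by rw [hY.maxRow_eq]; omega)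

theorem isFullColumn_of_lt_minRow (hY : IsYoungWall n Y) (hmax : maxRow Y (y + 1) ≤ i)
    (hmin : i < minRow Y y) : IsFullColumn n Y i y := by
  refine ⟨hY.lt_minRow.1 hmin, ?_⟩
  rintro ⟨j, z, s⟩ hb rfl
  by_contra! hz
  have hj := (hY.lt_maxRow (by simp only at hz; omega)).2 ⟨s, hb⟩
  exact absurd hmax (not_le.2 (hj.trans_le (hY.maxRow_antitone hz)))

theorem minRow_le (hY : IsYoungWall n Y) (y : ℕ) : minRow Y y ≤ maxRow Y (y + 1) + 1 := by
  by_contra! h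
  have heq := hY.proper _ _ _ (hY.isFullColumn_of_lt_minRow le_rfl (by omega))
    (hY.isFullColumn_of_lt_minRow (Nat.le_succ _) h)
  omega

theorem finite_minRow_ne (hY : IsYoungWall n Y) :
    {y | minRow Y y ≠ maxRow Y (y + 1)}.Finite := by
  obtain ⟨H, hH⟩ := hY.exists_bound
  refine (Set.finite_Iio H).subset fun y hy => Set.mem_Iio.2 <| not_le.1 fun hle => hy ?_
  simp [minRow, maxRow, hH y hle, hH (y + 1) (by omega)]

theorem finite_support_rowTilt (hY : IsYoungWall n Y) :
    (Function.support fun y => (-1) ^ minRow Y y * rowTilt Y y).Finite := by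
  obtain ⟨H, hH⟩ := hY.exists_bound
  refine (Set.finite_Iio H).subset fun y hy => Set.mem_Iio.2 <| not_le.1 fun hle => hy ?_
  simp [rowTilt, hH y hle]

/-- The profile of a Young wall, read off from the lengths of its rows. -/
noncomputable def profile (hY : IsYoungWall n Y) : Profile n where
  full := hY.finite_minRow_ne.toFinset
  half := Finsupp.ofSupportFinite _ hY.finite_support_rowTilt
  half_zero := by simp [Finsupp.ofSupportFinite, rowTilt]
  half_of_not_dvd y hy := by simp [Finsupp.ofSupportFinite, hY.rowTilt_of_not_dvd hy]

theorem half_profile (hY : IsYoungWall n Y) (y : ℕ) :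
    hY.profile.half y = (-1) ^ minRow Y y * rowTilt Y y := rfl

theorem minRow_eq (hY : IsYoungWall n Y) (y : ℕ) :
    minRow Y y = (if y ∈ hY.profile.full then 1 else 0) + maxRow Y (y + 1) := by
  have hle := hY.maxRow_succ_le y
  have hge := hY.minRow_le y
  simp only [profile, Set.Finite.mem_toFinset, Set.mem_ofPred_eq]
  split_ifs <;> omega

theorem top_profile (hY : IsYoungWall n Y) (y : ℕ) : hY.profile.top y = maxRow Y y := by
  obtain ⟨H, hH⟩ := hY.exists_bound
  have hmax : ∀ z, H ≤ z → maxRow Y z = 0 := fun z hz => by simp [maxRow, hH z hz]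
  have hmin : ∀ z, H ≤ z → minRow Y z = 0 := fun z hz => by simp [minRow, hH z hz]
  have hbound : ∀ z, H ≤ z → hY.profile.top z = maxRow Y z := fun z hz => by
    rw [hmax z hz]
    refine Profile.IsBound.top_eq_zero fun w hw => ⟨fun hmem => ?_, ?_⟩
    · exact (Set.Finite.mem_toFinset _).1 hmem (by rw [hmin w (by omega), hmax _ (by omega)])
    · rw [half_profile, rowTilt, hH w (by omega), hH w (by omega)]
      simp
  obtain hy | hy := le_total H y
  · exact hbound y hy
  · refine Nat.decreasingInduction' (P := fun z => hY.profile.top z = maxRow Y z)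
      (fun z _ _ ih => ?_) hy (hbound H le_rfl)
    rw [Profile.top_eq, Profile.low, ih, ← hY.minRow_eq, hY.maxRow_eq, half_profile,
      Int.natAbs_mul, Int.natAbs_pow, Int.natAbs_neg, Int.natAbs_one, one_pow, one_mul]

theorem low_profile (hY : IsYoungWall n Y) (y : ℕ) : hY.profile.low y = minRow Y y := by
  rw [Profile.low, hY.top_profile, ← hY.minRow_eq]

theorem tilt_profile (hY : IsYoungWall n Y) (y : ℕ) : hY.profile.tilt y = rowTilt Y y := by
  rw [Profile.tilt, hY.low_profile, hY.half_profile, ← mul_assoc, ← mul_pow]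
  simp

theorem row_profile (hY : IsYoungWall n Y) (hp : (⟨i, y, s⟩ : Block) ∈ pattern n)
    (hg : ¬ (y = 0 ∧ s = .lower)) : hY.profile.row y s = rowLength Y y s := by
  rw [Profile.row, hY.tilt_profile, hY.low_profile]
  by_cases hy : (n - 2) ∣ y
  · have hsquare := hY.rowLength_square hy
    unfold minRow rowTilt
    cases s
    · exact absurd hy (mem_pattern_square.1 hp)
    all_goals split_ifs <;> simp_all only [Shape.part] <;> first | omega | tauto
  · have h0 : y ≠ 0 := by rintro rfl; exact hy (dvd_zero _)
    cases s
    · simp [minRow, h0, Shape.part, hY.rowLength_upper hy]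
    · exact absurd (mem_pattern_upper.1 hp) hy
    · exact absurd (mem_pattern_lower.1 hp) hy

theorem wall_profile (hY : IsYoungWall n Y) : hY.profile.wall = Y := by
  ext ⟨i, y, s⟩
  rw [Profile.mem_wall]
  by_cases hp : (⟨i, y, s⟩ : Block) ∈ pattern n
  · by_cases hg : y = 0 ∧ s = .lower
    · exact iff_of_true ⟨hp, Or.inl hg⟩ (hY.grey_mem _ hp hg)
    · simp [hp, hg, hY.mem_iff hg, hY.row_profile hp hg]
  · exact iff_of_false (fun h => hp h.1) fun h => hp (hY.subset_pattern h)

end IsYoungWall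

/-- Young walls are classified by their profiles. -/
noncomputable def wallEquiv (n : ℕ) : Profile n ≃ YoungWall n :=
  Equiv.ofBijective (fun P => ⟨P.wall, P.isYoungWall_wall⟩)
    ⟨fun _ _ h => Profile.wall_injective (congrArg Subtype.val h),
      fun Y => ⟨Y.2.profile, Subtype.ext Y.2.wall_profile⟩⟩

/-! ### Salient blocks -/

theorem exists_mem_pattern (n i y : ℕ) : ∃ s, (⟨i, y, s⟩ : Block) ∈ pattern n := by
  by_cases hy : (n - 2) ∣ y
  exacts [⟨_, mem_pattern_upper.2 hy⟩, ⟨_, mem_pattern_square.2 hy⟩]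

theorem IsFullColumn.insert {n i y : ℕ} {Y : Set Block} {b : Block} (h : IsFullColumn n Y i y)
    (hb : b.lev ≤ y) : IsFullColumn n (insert b Y) i y := by
  refine ⟨fun c hc hcol hlev => Set.mem_insert_of_mem _ (h.1 c hc hcol hlev), ?_⟩
  rintro c (rfl | hc) hcol
  exacts [hb, h.2 c hc hcol]

theorem IsFullColumn.of_insert {n i y : ℕ} {Y : Set Block} {b : Block}
    (h : IsFullColumn n (Insert.insert b Y) i y) (hb : b.col ≠ i) : IsFullColumn n Y i y := by
  refine ⟨fun c hc hcol hlev => (h.1 c hc hcol hlev).resolve_left ?_,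
    fun c hc hcol => h.2 c (Set.mem_insert_of_mem _ hc) hcol⟩
  rintro rfl
  exact hb hcol

namespace Profile

variable {n : ℕ} {P : Profile n} {i y : ℕ} {s : Shape}

theorem lev_le_of_row_le (hi : P.row y s ≤ i) {c : Block} (hc : c ∈ P.wall) (hcol : c.col = i) :
    c.lev ≤ y := by
  by_contra! hz
  obtain ⟨j, z, s'⟩ := c
  have hlt := lt_top_of_mem_wall hc fun h => by simp [h.1] at hz
  have htop := P.top_antitone (show y + 1 ≤ z from hz)
  have hlow := (P.top_succ_le_low y).trans (P.low_le_row y s)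
  simp only at hcol
  omega

theorem forall_mem_insert_iff :
    (∀ c ∈ pattern n, c.col = i → c.lev = y → c ∈ insert (⟨i, y, s⟩ : Block) P.wall) ↔
      ∀ s', (⟨i, y, s'⟩ : Block) ∈ pattern n → s' = s ∨ (⟨i, y, s'⟩ : Block) ∈ P.wall := by
  constructor
  · intro h s' hs'
    simpa only [Set.mem_insert_iff, Block.mk.injEq, true_and] using h _ hs' rfl rfl
  · rintro h ⟨j, z, s'⟩ hs' rfl rfl
    simpa only [Set.mem_insert_iff, Block.mk.injEq, true_and] using h _ hs'

section Forward

variable (h : IsSalient n P.wall ⟨i, y, s⟩)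

include h

theorem not_grey_of_isSalient : ¬ (y = 0 ∧ s = .lower) := fun hg => h.2.1 ⟨h.1, Or.inl hg⟩

theorem eq_row_of_isSalient : i = P.row y s := by
  have hge : P.row y s ≤ i := not_lt.1 fun hlt => h.2.1 ⟨h.1, Or.inr hlt⟩
  obtain _ | k := i
  · omega
  · have hk := (h.2.2.left k y s (Set.mem_insert _ _)).resolve_left (by simp)
    have hlt := (mem_wall.1 hk).2.resolve_left (not_grey_of_isSalient h)
    omega

theorem lt_low_of_isSalient (hy : y ≠ 0) : i < P.low (y - 1) := by
  refine forall_mem_wall_iff.1 fun c hc hcol hlev => ?_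
  refine (h.2.2.column _ (Set.mem_insert _ _) c hc hcol
    (by simp only [hlev]; omega)).resolve_left ?_
  rintro rfl
  simp only at hlev
  omega

theorem notMem_full_of_isSalient (hall : ∀ s', (⟨i, y, s'⟩ : Block) ∈ pattern n →
    s' = s ∨ (⟨i, y, s'⟩ : Block) ∈ P.wall) : y ∉ P.full := by
  intro hy
  have hi := (eq_row_of_isSalient h).ge
  have hnew : IsFullColumn n (insert ⟨i, y, s⟩ P.wall) i y := by
    refine ⟨forall_mem_insert_iff.2 hall, ?_⟩
    rintro c (rfl | hc) hcol
    exacts [le_rfl, lev_le_of_row_le hi hc hcol]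
  have hold : IsFullColumn n (insert ⟨i, y, s⟩ P.wall) (P.top (y + 1)) y :=
    (isFullColumn_wall_iff.2 ⟨hy, rfl⟩).insert le_rfl
  have heq := h.2.2.proper _ _ _ hnew hold
  have hlow := P.low_le_row y s
  rw [low, if_pos hy] at hlow
  omega

end Forward

theorem proper_insert (hi : i = P.row y s) (hfull : (∀ s', (⟨i, y, s'⟩ : Block) ∈ pattern n →
      s' = s ∨ (⟨i, y, s'⟩ : Block) ∈ P.wall) → y ∉ P.full) (j k z : ℕ)
    (hj : IsFullColumn n (insert ⟨i, y, s⟩ P.wall) j z)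
    (hk : IsFullColumn n (insert ⟨i, y, s⟩ P.wall) k z) : j = k := by
  have hother : ∀ j z, IsFullColumn n (insert ⟨i, y, s⟩ P.wall) i z →
      ¬ IsFullColumn n P.wall j z := by
    intro j z hnew hold
    have hzy : z ≤ y := by
      obtain ⟨s', hs'⟩ := exists_mem_pattern n i z
      obtain h | h := hnew.1 _ hs' rfl rfl
      · exact (congrArg Block.lev h).le
      · exact lev_le_of_row_le hi.ge h rfl
    obtain rfl : z = y := le_antisymm hzy (hnew.2 ⟨i, y, s⟩ (Set.mem_insert _ _) rfl)
    exact hfull (forall_mem_insert_iff.1 hnew.1) (isFullColumn_wall_iff.1 hold).1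
  by_cases hij : i = j <;> by_cases hik : i = k
  · rw [← hij, ← hik]
  · exact absurd (hk.of_insert hik) (hother _ _ (hij ▸ hj))
  · exact absurd (hj.of_insert hij) (hother _ _ (hik ▸ hk))
  · exact P.isYoungWall_wall.proper _ _ _ (hj.of_insert hij) (hk.of_insert hik)

theorem isYoungWall_insert (hp : (⟨i, y, s⟩ : Block) ∈ pattern n) (hi : i = P.row y s)
    (hbelow : y = 0 ∨ i < P.low (y - 1)) (hfull : (∀ s', (⟨i, y, s'⟩ : Block) ∈ pattern n →
      s' = s ∨ (⟨i, y, s'⟩ : Block) ∈ P.wall) → y ∉ P.full) :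
    IsYoungWall n (insert ⟨i, y, s⟩ P.wall) where
  subset_pattern := Set.insert_subset hp P.isYoungWall_wall.subset_pattern
  grey_mem b hb hg := Set.mem_insert_of_mem _ (P.isYoungWall_wall.grey_mem b hb hg)
  finite_white := by
    refine (P.isYoungWall_wall.finite_white.insert ⟨i, y, s⟩).subset ?_
    rintro b ⟨rfl | hb, hg⟩
    exacts [Set.mem_insert _ _, Set.mem_insert_of_mem _ ⟨hb, hg⟩]
  column := by
    rintro b (rfl | hb) c hc hcol hlev
    · simp only at hcol hlev
      exact Set.mem_insert_of_mem _ <|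
        forall_mem_wall_iff.2 (hbelow.resolve_left (by omega)) c hc hcol (by omega)
    · exact Set.mem_insert_of_mem _ (P.isYoungWall_wall.column b hb c hc hcol hlev)
  left := by
    rintro j z s' (h | h)
    · obtain ⟨hj, rfl, rfl⟩ := Block.mk.inj h
      exact Set.mem_insert_of_mem _ (mem_wall.2 ⟨hp, Or.inr (by omega)⟩)
    · exact Set.mem_insert_of_mem _ (P.isYoungWall_wall.left _ _ _ h)
  proper := proper_insert hi hfull

theorem isSalient_wall_iff : IsSalient n P.wall ⟨i, y, s⟩ ↔
    (⟨i, y, s⟩ : Block) ∈ pattern n ∧ ¬ (y = 0 ∧ s = .lower) ∧ i = P.row y s ∧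
      (y = 0 ∨ i < P.low (y - 1)) ∧
      ((∀ s', (⟨i, y, s'⟩ : Block) ∈ pattern n → s' = s ∨ (⟨i, y, s'⟩ : Block) ∈ P.wall) →
        y ∉ P.full) := by
  constructor
  · exact fun h => ⟨h.1, not_grey_of_isSalient h, eq_row_of_isSalient h,
      or_iff_not_imp_left.2 (lt_low_of_isSalient h), notMem_full_of_isSalient h⟩
  · rintro ⟨hp, hg, hi, hbelow, hfull⟩
    refine ⟨hp, fun h => ?_, isYoungWall_insert hp hi hbelow hfull⟩
    exact ((mem_wall.1 h).2.resolve_left hg).ne hi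

theorem isSalient_square_iff : IsSalient n P.wall ⟨i, y, .square⟩ ↔
    ¬ (n - 2) ∣ y ∧ i = P.low y ∧ y - 1 ∈ P.full ∧ y ∉ P.full := by
  rw [isSalient_wall_iff, mem_pattern_square, row_square]
  refine and_congr_right fun hy => ?_
  obtain _ | z := y
  · exact absurd (dvd_zero _) hy
  have hall : ∀ s', (⟨i, z + 1, s'⟩ : Block) ∈ pattern n → s' = .square ∨
      (⟨i, z + 1, s'⟩ : Block) ∈ P.wall := by
    rintro (_ | _ | _) hs'
    exacts [Or.inl rfl, absurd (mem_pattern_upper.1 hs') hy, absurd (mem_pattern_lower.1 hs') hy]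
  have htop : P.top (z + 1) = P.low (z + 1) := top_of_half_eq_zero (P.half_of_not_dvd _ hy)
  simp only [Nat.add_eq_zero_iff, one_ne_zero, and_false, false_and, not_false_eq_true, true_and,
    false_or, Nat.add_sub_cancel, imp_iff_right hall]
  refine and_congr_right fun hi => and_congr_left fun _ => ?_
  rw [low, htop, hi]
  split_ifs with hz <;> simp [hz]

theorem isSalient_half_iff (hs : s ≠ .square) (hy0 : y ≠ 0) :
    IsSalient n P.wall ⟨i, y, s⟩ ↔ (n - 2) ∣ y ∧ i = P.row y s ∧ P.row y s < P.low (y - 1) ∧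
      (P.row y s < P.row y s.flip → y ∉ P.full) := by
  rw [isSalient_wall_iff, mem_pattern_of_ne_square hs]
  refine and_congr_right fun hy => ?_
  have hall : (∀ s', (⟨i, y, s'⟩ : Block) ∈ pattern n → s' = s ∨
      (⟨i, y, s'⟩ : Block) ∈ P.wall) ↔ i < P.row y s.flip := by
    have hflip : s.flip ≠ .square ∧ s.flip ≠ s := by cases s <;> simp_all [Shape.flip]
    have hp : (⟨i, y, s.flip⟩ : Block) ∈ pattern n := (mem_pattern_of_ne_square hflip.1).2 hy
    constructor
    · intro h
      exact (mem_wall.1 ((h _ hp).resolve_left hflip.2)).2.resolve_left (by simp [hy0])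
    · intro h s' hs'
      refine or_iff_not_imp_left.2 fun hne => mem_wall.2 ⟨hs', Or.inr ?_⟩
      have hsquare : s' ≠ .square := by
        rintro rfl
        exact mem_pattern_square.1 hs' hy
      have heq : s' = s.flip := by cases s <;> cases s' <;> simp_all [Shape.flip]
      rwa [heq]
  simp only [hall, hy0, false_and, not_false_eq_true, true_and, false_or]
  exact and_congr_right fun hi => by rw [hi]

theorem isSalient_zero_iff :
    IsSalient n P.wall ⟨i, 0, s⟩ ↔ s = .upper ∧ i = P.low 0 ∧ 0 ∉ P.full := by
  rw [isSalient_wall_iff]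
  cases s
  · simp [mem_pattern_square]
  · have hall : ∀ s', (⟨i, 0, s'⟩ : Block) ∈ pattern n → s' = .upper ∨
        (⟨i, 0, s'⟩ : Block) ∈ P.wall := by
      rintro (_ | _ | _) hs'
      exacts [absurd (dvd_zero _) (mem_pattern_square.1 hs'), Or.inl rfl,
        Or.inr (mem_wall.2 ⟨hs', Or.inl ⟨rfl, rfl⟩⟩)]
    simp only [mem_pattern_upper, dvd_zero, true_or, reduceCtorEq, and_false, not_false_eq_true,
      true_and, row_of_half_eq_zero P.half_zero, imp_iff_right hall]
  · simp

end Profile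

section Label

variable {n : ℕ} (hn : 4 ≤ n)

include hn

theorem dvd_iff_mod_period (y : ℕ) :
    (n - 2) ∣ y ↔ y % (2 * n - 4) = 0 ∨ y % (2 * n - 4) = n - 2 := by
  have hperiod : 2 * n - 4 = (n - 2) * 2 := by omega
  constructor
  · rintro ⟨c, rfl⟩
    rw [hperiod, Nat.mul_mod_mul_left]
    rcases Nat.mod_two_eq_zero_or_one c with h | h <;> simp [h]
  · intro h
    rw [← Nat.div_add_mod y (2 * n - 4)]
    refine dvd_add (Dvd.dvd.mul_right (hperiod ▸ dvd_mul_right _ _) _) ?_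
    rcases h with h | h <;> simp [h]

theorem not_dvd_succ {y : ℕ} (h : (n - 2) ∣ y) : ¬ (n - 2) ∣ y + 1 := fun h' => by
  have := Nat.le_of_dvd one_pos ((Nat.dvd_add_right h).1 h')
  omega

theorem ne_zero_of_mod {y : ℕ} (hy : y % (2 * n - 4) = n - 2) : y ≠ 0 := by
  rintro rfl
  rw [Nat.zero_mod] at hy
  omega

omit hn in
theorem halfIndex_le (b : Block) : b.halfIndex ≤ 1 := by
  obtain ⟨i, y, s⟩ := b
  cases s <;> simp only [Block.halfIndex] <;> omega

omit hn in
theorem label_of_mod_eq_zero {b : Block} (h : b.lev % (2 * n - 4) = 0) :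
    label n b = b.halfIndex := by simp [label, h]

theorem label_of_mod_eq {b : Block} (h : b.lev % (2 * n - 4) = n - 2) :
    label n b = n - 1 + b.halfIndex := by
  rw [label, if_neg (by omega), if_pos h]

theorem label_of_not_dvd {b : Block} (h : ¬ (n - 2) ∣ b.lev) :
    2 ≤ label n b ∧ label n b ≤ n - 2 := by
  rw [dvd_iff_mod_period hn, not_or] at h
  have hlt : b.lev % (2 * n - 4) < 2 * n - 4 := Nat.mod_lt _ (by omega)
  rw [label, if_neg h.1, if_neg h.2]
  split_ifs <;> omega

theorem label_eq_pred_or_eq_iff {b : Block} :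
    label n b = n - 1 ∨ label n b = n ↔ b.lev % (2 * n - 4) = n - 2 := by
  have hidx := halfIndex_le b
  by_cases hdvd : (n - 2) ∣ b.lev
  · obtain hy | hy := (dvd_iff_mod_period hn _).1 hdvd
    · rw [label_of_mod_eq_zero hy]; omega
    · rw [label_of_mod_eq hn hy]; omega
  · have hlab := label_of_not_dvd hn hdvd
    rw [dvd_iff_mod_period hn] at hdvd
    omega

theorem label_mem_Icc_iff {b : Block} : label n b ∈ Set.Icc 1 (n - 2) ↔
    ¬ (n - 2) ∣ b.lev ∨ (b.lev % (2 * n - 4) = 0 ∧ b.halfIndex = 1) := by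
  have hidx := halfIndex_le b
  rw [Set.mem_Icc]
  by_cases hdvd : (n - 2) ∣ b.lev
  · obtain hy | hy := (dvd_iff_mod_period hn _).1 hdvd
    · simp only [label_of_mod_eq_zero hy, hdvd, hy, not_true_eq_false, false_or, true_and]
      omega
    · simp only [label_of_mod_eq hn hy, hdvd, hy, not_true_eq_false, false_or]
      omega
  · have hlab := label_of_not_dvd hn hdvd
    simp only [hdvd, not_false_eq_true, true_or, iff_true]
    omega

end Label

theorem Shape.flip_ne_square {s : Shape} (hs : s ≠ .square) : s.flip ≠ .square := by
  cases s <;> simp_all [flip]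

theorem Shape.flip_flip (s : Shape) : s.flip.flip = s := by cases s <;> rfl

namespace Profile

variable {n : ℕ} (P : Profile n) {i y : ℕ} {s : Shape}

section Rows

variable {P}

theorem low_lt_top_iff : P.low y < P.top y ↔ P.half y ≠ 0 := by
  rw [top_eq]; omega

theorem low_pred (hy : y ≠ 0) :
    P.low (y - 1) = (if y - 1 ∈ P.full then 1 else 0) + P.top y := by
  rw [low, Nat.sub_add_cancel (Nat.pos_of_ne_zero hy)]

theorem row_eq_low_or_top (hs : s ≠ .square) :
    (P.row y s = P.low y ∧ P.row y s.flip = P.top y) ∨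
      (P.row y s = P.top y ∧ P.row y s.flip = P.low y) := by
  rw [top_eq, ← natAbs_tilt]
  cases s
  · exact absurd rfl hs
  all_goals simp only [row, Shape.part, Shape.flip]; omega

end Rows

theorem exists_row_eq_low (y : ℕ) :
    ∃ s : Shape, s ≠ .square ∧ P.row y s = P.low y ∧ P.row y s.flip = P.top y := by
  obtain h | h := row_eq_low_or_top (P := P) (y := y) (s := .upper) (by simp)
  · exact ⟨.upper, by simp, h⟩
  · exact ⟨.lower, by simp, h.2, h.1⟩

section UpperLabels

variable {P} (hn : 4 ≤ n) (hy : y % (2 * n - 4) = n - 2)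

include hn hy

theorem mem_full_of_half_ne_zero (hflip : ∀ i s, IsSalient n P.wall ⟨i, y, s⟩ →
    IsSalient n P.wall ⟨i, y, s.flip⟩) (hhalf : P.half y ≠ 0) : y ∈ P.full := by
  have hy0 := ne_zero_of_mod hn hy
  have hdvd := (dvd_iff_mod_period hn y).2 (Or.inr hy)
  obtain ⟨s, hs, hrow, hrow'⟩ := P.exists_row_eq_low y
  have hlt := low_lt_top_iff.2 hhalf
  have hpred := low_pred (P := P) hy0
  by_contra hfull
  have hsal : IsSalient n P.wall ⟨P.low y, y, s⟩ :=
    (isSalient_half_iff hs hy0).2 ⟨hdvd, hrow.symm, by omega, fun _ => hfull⟩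
  have heq := eq_row_of_isSalient (hflip _ _ hsal)
  omega

theorem half_eq_zero_of_pred_mem_full (hsupp : ∀ i s, IsSalient n P.wall ⟨i, y, s⟩ →
    IsSalient n P.wall ⟨i, y, s.flip⟩ ∧ IsDirectlySupported n P.wall ⟨i, y, s⟩)
    (hpred : y - 1 ∈ P.full) : P.half y = 0 ∧ y ∈ P.full := by
  have hy0 := ne_zero_of_mod hn hy
  have hdvd := (dvd_iff_mod_period hn y).2 (Or.inr hy)
  obtain ⟨s, hs, hrow, hrow'⟩ := P.exists_row_eq_low y
  have hlow := low_pred (P := P) hy0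
  rw [if_pos hpred] at hlow
  have hsal : IsSalient n P.wall ⟨P.top y, y, s.flip⟩ := by
    refine (isSalient_half_iff (Shape.flip_ne_square hs) hy0).2
      ⟨hdvd, hrow'.symm, by omega, fun h => ?_⟩
    rw [Shape.flip_flip, hrow, hrow'] at h
    exact absurd (P.low_le_top y) (not_le.2 h)
  obtain ⟨hsal', -, -, -, ⟨j, z, s'⟩, hc, hmissing, hcol, hlev⟩ := hsupp _ _ hsal
  rw [Shape.flip_flip] at hsal'
  have htop : P.top y = P.low y := (eq_row_of_isSalient hsal').trans hrow
  refine ⟨not_not.1 fun h => (low_lt_top_iff.2 h).ne' htop, ?_⟩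
  by_contra hfull
  simp only at hcol hlev
  subst hlev
  have hsucc := P.half_of_not_dvd _ (not_dvd_succ hn hdvd)
  refine hmissing (mem_wall.2 ⟨hc, Or.inr ?_⟩)
  rw [row_of_half_eq_zero hsucc, ← top_of_half_eq_zero hsucc]
  have hlow' : P.low y = P.top (y + 1) := by simp [low, hfull]
  omega

theorem isDirectlySupported_of_isSalient (hfull : P.half y ≠ 0 → y ∈ P.full)
    (hpred : y - 1 ∈ P.full → P.half y = 0 ∧ y ∈ P.full)
    (hsal : IsSalient n P.wall ⟨i, y, s⟩) :
    IsSalient n P.wall ⟨i, y, s.flip⟩ ∧ IsDirectlySupported n P.wall ⟨i, y, s⟩ := by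
  have hy0 := ne_zero_of_mod hn hy
  have hdvd := (dvd_iff_mod_period hn y).2 (Or.inr hy)
  have hlow := low_pred (P := P) hy0
  have hs : s ≠ .square := fun h => mem_pattern_square.1 (h ▸ hsal.1) hdvd
  obtain ⟨-, hi, hlt, hnotfull⟩ := (isSalient_half_iff hs hy0).1 hsal
  have hrow := row_eq_low_or_top (P := P) (y := y) hs
  have hhalf : P.half y = 0 := by
    by_contra h0
    have hmem := hfull h0
    have hlt' := low_lt_top_iff.2 h0
    rw [if_neg fun h => h0 (hpred h).1] at hlow
    rcases hrow with h | h
    · exact hnotfull (by omega) hmem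
    · omega
  have htop := top_of_half_eq_zero hhalf
  have hmem : y - 1 ∈ P.full := by
    by_contra h
    rw [if_neg h] at hlow
    omega
  have hsal' : IsSalient n P.wall ⟨i, y, s.flip⟩ := by
    refine (isSalient_half_iff (Shape.flip_ne_square hs) hy0).2 ⟨hdvd, by omega, by omega, ?_⟩
    rw [Shape.flip_flip]
    omega
  refine ⟨hsal', hsal.2.1, hsal'.2.1, fun c hc hcol hlev => ?_,
    ⟨P.top (y + 1), y + 1, .square⟩, mem_pattern_square.2 (not_dvd_succ hn hdvd), fun h => ?_,
    ?_, rfl⟩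
  · simp only at hcol hlev
    exact forall_mem_wall_iff.2 (show i < P.low (y - 1) by omega) c hc hcol (by omega)
  · exact (lt_top_of_mem_wall h (by simp)).false
  · have hlow' : P.low y = 1 + P.top (y + 1) := by rw [low, if_pos (hpred hmem).2]
    simp only
    omega

end UpperLabels

theorem upperLabels_iff (hn : 4 ≤ n) :
    (∀ b, IsSalient n P.wall b → label n b = n - 1 ∨ label n b = n →
      IsSalient n P.wall b.flip ∧ IsDirectlySupported n P.wall b ∧
        IsDirectlySupported n P.wall b.flip) ↔
    ∀ y, y % (2 * n - 4) = n - 2 →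
      (P.half y ≠ 0 → y ∈ P.full) ∧ (y - 1 ∈ P.full → P.half y = 0 ∧ y ∈ P.full) := by
  simp only [label_eq_pred_or_eq_iff hn]
  constructor
  · exact fun h y hy =>
      ⟨mem_full_of_half_ne_zero hn hy fun i s hsal => (h ⟨i, y, s⟩ hsal hy).1,
        half_eq_zero_of_pred_mem_full hn hy fun i s hsal =>
          ⟨(h ⟨i, y, s⟩ hsal hy).1, (h ⟨i, y, s⟩ hsal hy).2.1⟩⟩
  · rintro h ⟨i, y, s⟩ hsal hy
    obtain ⟨hfull, hpred⟩ := h y hy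
    have hflip := isDirectlySupported_of_isSalient hn hy hfull hpred hsal
    exact ⟨hflip.1, hflip.2, (isDirectlySupported_of_isSalient hn hy hfull hpred hflip.1).2⟩

theorem tilt_eq_or (y : ℕ) :
    (P.low y % 2 = 0 ∧ P.tilt y = P.half y) ∨ (P.low y % 2 = 1 ∧ P.tilt y = -P.half y) := by
  obtain h | h := Nat.mod_two_eq_zero_or_one (P.low y)
  · exact Or.inl ⟨h, tilt_of_even h⟩
  · exact Or.inr ⟨h, tilt_of_odd h⟩

theorem forall_isSalient_half_iff (hy0 : y ≠ 0) (hdvd : (n - 2) ∣ y) :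
    (∀ i s, IsSalient n P.wall ⟨i, y, s⟩ → (⟨i, y, s⟩ : Block).halfIndex ≠ 1) ↔
      (P.row y .upper < P.low (y - 1) → (P.row y .upper < P.row y .lower → y ∉ P.full) →
        P.row y .upper % 2 ≠ 1) ∧
      (P.row y .lower < P.low (y - 1) → (P.row y .lower < P.row y .upper → y ∉ P.full) →
        (P.row y .lower + 1) % 2 ≠ 1) := by
  constructor
  · exact fun h =>
      ⟨fun hlt hfull => h _ _ ((isSalient_half_iff (by simp) hy0).2 ⟨hdvd, rfl, hlt, hfull⟩),
        fun hlt hfull => h _ _ ((isSalient_half_iff (by simp) hy0).2 ⟨hdvd, rfl, hlt, hfull⟩)⟩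
  · rintro ⟨hupper, hlower⟩ i s hsal
    cases s
    · exact absurd hdvd (mem_pattern_square.1 hsal.1)
    · obtain ⟨-, rfl, hlt, hfull⟩ := (isSalient_half_iff (by simp) hy0).1 hsal
      exact hupper hlt hfull
    · obtain ⟨-, rfl, hlt, hfull⟩ := (isSalient_half_iff (by simp) hy0).1 hsal
      exact hlower hlt hfull

theorem halfIndex_ne_one_iff (hy0 : y ≠ 0) (hdvd : (n - 2) ∣ y) :
    (∀ i s, IsSalient n P.wall ⟨i, y, s⟩ → (⟨i, y, s⟩ : Block).halfIndex ≠ 1) ↔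
      (y - 1 ∈ P.full → P.half y ≠ 0 ∧ (0 < P.half y ↔ P.half y % 2 = 0)) ∧
        (0 < P.half y → y ∈ P.full) := by
  rw [P.forall_isSalient_half_iff hy0 hdvd, low_pred hy0, top_eq]
  have htilt := P.tilt_eq_or y
  simp only [row, Shape.part]
  by_cases hpred : y - 1 ∈ P.full <;> by_cases hfull : y ∈ P.full <;>
    simp only [hpred, hfull, if_true, if_false, not_true_eq_false, not_false_eq_true, imp_true_iff,
      imp_false, true_imp_iff, false_imp_iff, true_and, and_true, iff_true] <;>
    omega

theorem lowerLabels_iff (hn : 4 ≤ n) :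
    (∀ b, IsSalient n P.wall b → label n b ∉ Set.Icc 1 (n - 2)) ↔
      (∀ y, ¬ (n - 2) ∣ y → y - 1 ∈ P.full → y ∈ P.full) ∧
      (∀ y, y ≠ 0 → y % (2 * n - 4) = 0 →
        (y - 1 ∈ P.full → P.half y ≠ 0 ∧ (0 < P.half y ↔ P.half y % 2 = 0)) ∧
          (0 < P.half y → y ∈ P.full)) ∧
      (0 ∉ P.full → P.top 0 % 2 = 0) := by
  simp only [label_mem_Icc_iff hn, not_or, not_and]
  rw [top_of_half_eq_zero P.half_zero]
  constructor
  · intro h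
    refine ⟨fun y hy hpred => ?_, fun y hy0 hy => ?_, fun h0 => ?_⟩
    · by_contra hfull
      exact (h _ (isSalient_square_iff.2 ⟨hy, rfl, hpred, hfull⟩)).1 hy
    · rw [← P.halfIndex_ne_one_iff hy0 ((dvd_iff_mod_period hn y).2 (Or.inl hy))]
      exact fun i s hsal => (h _ hsal).2 hy
    · have hidx := (h _ (isSalient_zero_iff.2 ⟨rfl, rfl, h0⟩)).2 (Nat.zero_mod _)
      simp only [Block.halfIndex] at hidx
      omega
  · rintro ⟨hsquare, hhalf, hzero⟩ ⟨i, y, s⟩ hsal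
    have hdvd : (n - 2) ∣ y := by
      by_contra hdvd
      have hs : s = .square := hsal.1.2 hdvd
      subst hs
      obtain ⟨-, -, hpred, hfull⟩ := isSalient_square_iff.1 hsal
      exact hfull (hsquare y hdvd hpred)
    refine ⟨not_not.2 hdvd, fun hy => ?_⟩
    obtain rfl | hy0 := eq_or_ne y 0
    · obtain ⟨rfl, rfl, h0⟩ := isSalient_zero_iff.1 hsal
      have heven := hzero h0
      simp only [Block.halfIndex]
      omega
    · exact (P.halfIndex_ne_one_iff hy0 hdvd).2 (hhalf y hy0 hy) i s hsal

theorem endsInHalf_wall_iff (hy0 : y ≠ 0) (hy : (n - 2) ∣ y) :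
    EndsInHalf P.wall i y ↔ P.low y ≤ i ∧ i < P.top y := by
  have hmem : ∀ i (s : Shape), s ≠ .square → ((⟨i, y, s⟩ : Block) ∈ P.wall ↔ i < P.row y s) := by
    intro i s hs
    rw [mem_wall, mem_pattern_of_ne_square hs]
    simp [hy, hy0]
  constructor
  · rintro ⟨⟨i, y, s⟩, hb, rfl, rfl, hs, hflip⟩
    have hlt : i < P.row y s := (hmem i s hs).1 hb
    have hge : ¬ i < P.row y s.flip := fun h => hflip ((hmem i _ (Shape.flip_ne_square hs)).2 h)
    have hle := P.low_le_top y
    change P.low y ≤ i ∧ i < P.top y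
    rcases row_eq_low_or_top (P := P) (y := y) hs with ⟨h, h'⟩ | ⟨h, h'⟩ <;>
      rw [h] at hlt <;> rw [h'] at hge <;> omega
  · rintro ⟨hlow, htop⟩
    obtain ⟨s, hs, hrow, hrow'⟩ := P.exists_row_eq_low y
    refine ⟨⟨i, y, s.flip⟩, (hmem _ _ (Shape.flip_ne_square hs)).2 (by omega), rfl, rfl,
      Shape.flip_ne_square hs, ?_⟩
    simp only [Block.flip, Shape.flip_flip]
    rw [hmem _ _ hs]
    omega

theorem setOf_endsInHalf_wall (hy0 : y ≠ 0) (hy : (n - 2) ∣ y) :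
    {i | EndsInHalf P.wall i y} = ↑(Finset.Ico (P.low y) (P.top y)) := by
  ext i
  rw [Finset.coe_Ico]
  exact P.endsInHalf_wall_iff hy0 hy

theorem forall_series_longer_iff (hn : 4 ≤ n) :
    (∀ y, y % (2 * n - 4) = n - 2 → (∃ i, EndsInHalf P.wall i y) →
      n - 1 < {i | EndsInHalf P.wall i y}.ncard) ↔
    ∀ y, y % (2 * n - 4) = n - 2 → P.half y ≠ 0 → n - 1 < (P.half y).natAbs := by
  refine forall_congr' fun y => forall_congr' fun hy => ?_
  have hset := P.setOf_endsInHalf_wall (ne_zero_of_mod hn hy)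
    ((dvd_iff_mod_period hn y).2 (Or.inr hy))
  have hex : (∃ i, EndsInHalf P.wall i y) ↔ P.half y ≠ 0 := by
    change {i | EndsInHalf P.wall i y}.Nonempty ↔ _
    rw [hset, Finset.coe_nonempty, Finset.nonempty_Ico, low_lt_top_iff]
  rw [hex, hset, Set.ncard_coe_finset, Nat.card_Ico, top_eq, Nat.add_sub_cancel]

theorem isDistinguished_wall_iff (hn : 4 ≤ n) : IsDistinguished n P.wall ↔
    (∀ y, y % (2 * n - 4) = n - 2 →
      (P.half y ≠ 0 → y ∈ P.full ∧ n - 1 < (P.half y).natAbs) ∧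
        (y - 1 ∈ P.full → P.half y = 0 ∧ y ∈ P.full)) ∧
    (∀ y, ¬ (n - 2) ∣ y → y - 1 ∈ P.full → y ∈ P.full) ∧
    (∀ y, y ≠ 0 → y % (2 * n - 4) = 0 →
      (y - 1 ∈ P.full → P.half y ≠ 0 ∧ (0 < P.half y ↔ P.half y % 2 = 0)) ∧
        (0 < P.half y → y ∈ P.full)) ∧
    (0 ∉ P.full → P.top 0 % 2 = 0) := by
  rw [IsDistinguished, IsZeroGenerated, P.forall_series_longer_iff hn, P.upperLabels_iff hn,
    P.lowerLabels_iff hn]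
  constructor
  · rintro ⟨⟨hupper, hlower⟩, hlong⟩
    exact ⟨fun y hy => ⟨fun h => ⟨(hupper y hy).1 h, hlong y hy h⟩, (hupper y hy).2⟩, hlower⟩
  · rintro ⟨hupper, hlower⟩
    exact ⟨⟨fun y hy => ⟨fun h => ((hupper y hy).1 h).1, (hupper y hy).2⟩, hlower⟩,
      fun y hy h => ((hupper y hy).1 h).2⟩

end Profile

/-! ### Weights -/

theorem card_range_filter_odd (m : ℕ) : #{i ∈ range m | (i + 1) % 2 = 0} = m / 2 := by
  simpa only [Nat.dvd_iff_mod_eq_zero] using Nat.card_multiples m 2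

theorem card_range_filter_even (m : ℕ) : #{i ∈ range m | i % 2 = 0} = (m + 1) / 2 := by
  have hsplit := card_filter_add_card_filter_not (s := range m) fun i => i % 2 = 0
  have hodd : #{i ∈ range m | ¬ i % 2 = 0} = m / 2 := by
    rw [← card_range_filter_odd]
    exact congrArg card (filter_congr fun i _ => by omega)
  rw [hodd, card_range] at hsplit
  omega

section Counting

variable {n : ℕ}

theorem label_le (hn : 4 ≤ n) (b : Block) : label n b ≤ n := by
  have hidx := halfIndex_le b
  by_cases hdvd : (n - 2) ∣ b.lev
  · rcases (dvd_iff_mod_period hn _).1 hdvd with hy | hy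
    · rw [label_of_mod_eq_zero hy]; omega
    · rw [label_of_mod_eq hn hy]; omega
  · have hlab := label_of_not_dvd hn hdvd
    omega

theorem label_eq_zero_iff (hn : 4 ≤ n) {b : Block} :
    label n b = 0 ↔ b.lev % (2 * n - 4) = 0 ∧ b.halfIndex = 0 := by
  by_cases hdvd : (n - 2) ∣ b.lev
  · rcases (dvd_iff_mod_period hn _).1 hdvd with hy | hy
    · rw [label_of_mod_eq_zero hy, and_iff_right hy]
    · rw [label_of_mod_eq hn hy]; omega
  · have hlab := label_of_not_dvd hn hdvd
    rw [dvd_iff_mod_period hn] at hdvd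
    omega

/-- The number of white blocks and half-blocks of a set of blocks. -/
noncomputable def whites (Y : Set Block) : ℕ := {b ∈ Y | ¬ b.IsGrey}.ncard

theorem sum_wt (hn : 4 ≤ n) {Y : Set Block} (hY : IsYoungWall n Y) :
    ∑ j ∈ range (n + 1), wt n Y j = whites Y := by
  classical
  have hfin := hY.finite_white
  have hwt : ∀ j, wt n Y j = #{b ∈ hfin.toFinset | label n b = j} := by
    intro j
    rw [wt, ← Set.ncard_coe_finset]
    congr 1
    ext b
    simp [and_assoc]
  rw [whites, Set.ncard_eq_toFinset_card _ hfin, sum_congr rfl fun j _ => hwt j]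
  refine (card_eq_sum_card_fiberwise fun b _ => ?_).symm
  simpa [Nat.lt_succ_iff] using label_le hn b

end Counting

namespace Profile

variable {n : ℕ} (P : Profile n) {y H : ℕ}

open Classical in
/-- The number of white blocks of shape `s` at level `y` with the property `p`. -/
noncomputable def rowCount (p : Block → Prop) (y : ℕ) (s : Shape) : ℕ :=
  if (⟨0, y, s⟩ : Block) ∈ pattern n ∧ ¬ (y = 0 ∧ s = .lower) then
    #{i ∈ range (P.row y s) | p ⟨i, y, s⟩} else 0

variable {P} in
theorem ncard_white_eq_sum (hH : P.IsBound H) (p : Block → Prop) :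
    {b ∈ P.wall | ¬ b.IsGrey ∧ p b}.ncard = ∑ y ∈ range H,
      (P.rowCount p y .square + P.rowCount p y .upper + P.rowCount p y .lower) := by
  classical
  let rows := {x ∈ range H ×ˢ ({.square, .upper, .lower} : Finset Shape) |
    (⟨0, x.1, x.2⟩ : Block) ∈ pattern n ∧ ¬ (x.1 = 0 ∧ x.2 = .lower)}
  let blocks := rows.sigma fun x => {i ∈ range (P.row x.1 x.2) | p ⟨i, x.1, x.2⟩}
  let toBlock : (Σ _ : ℕ × Shape, ℕ) → Block := fun x => ⟨x.2, x.1.1, x.1.2⟩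
  have hinj : Function.Injective toBlock := by
    rintro ⟨⟨y, s⟩, i⟩ ⟨⟨y', s'⟩, i'⟩ h
    obtain ⟨rfl, rfl, rfl⟩ := Block.mk.inj h
    rfl
  have hset : {b ∈ P.wall | ¬ b.IsGrey ∧ p b} = (↑(blocks.image toBlock) : Set Block) := by
    ext ⟨i, y, s⟩
    simp only [coe_image, Set.mem_image, mem_coe, blocks, rows, mem_sigma, mem_filter, mem_product,
      mem_range]
    constructor
    · rintro ⟨hb, hg, hp⟩
      have hi := (mem_wall.1 hb).2.resolve_left hg
      have hy : y < H := by
        by_contra hy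
        have htop := (hH.mono (not_lt.1 hy)).top_eq_zero
        have hle := P.row_le_top y s
        omega
      exact ⟨⟨⟨y, s⟩, i⟩, ⟨⟨⟨hy, by cases s <;> simp⟩, hb.1, hg⟩, hi, hp⟩, rfl⟩
    · rintro ⟨⟨⟨y', s'⟩, i'⟩, ⟨⟨-, hp, hg⟩, hi, hpi⟩, h⟩
      obtain ⟨rfl, rfl, rfl⟩ := Block.mk.inj h
      exact ⟨⟨hp, Or.inr hi⟩, hg, hpi⟩
  rw [hset, Set.ncard_coe_finset, card_image_of_injective _ hinj, card_sigma, sum_filter,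
    sum_product]
  refine sum_congr rfl fun y _ => ?_
  rw [sum_insert (by simp), sum_insert (by simp), sum_singleton, ← add_assoc]
  rfl

section RowSums

variable {R : Type*} [CommSemiring R] (f : ℕ → R)

-- A column that ends at level `y` in a full block contributes to `low z` for `z ≤ y`, one that ends
-- in a half-block for `z < y`.
variable {P} in
theorem sum_mul_low (hH : P.IsBound H) : ∑ y ∈ range H, f y * P.low y =
    ∑ y ∈ range H, ((if y ∈ P.full then 1 else 0) * ∑ z ∈ range (y + 1), f z +
      (P.half y).natAbs * ∑ z ∈ range y, f z) := by
  suffices hadd : ∀ K, ∑ y ∈ range K, f y * P.low y =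
      ∑ y ∈ range K, ((if y ∈ P.full then 1 else 0) * ∑ z ∈ range (y + 1), f z +
        (P.half y).natAbs * ∑ z ∈ range y, f z) + (∑ z ∈ range K, f z) * P.top K by
    rw [hadd, hH.top_eq_zero, Nat.cast_zero, mul_zero, add_zero]
  intro K
  induction K with
  | zero => simp
  | succ K ih =>
    have hlow : P.low K = (if K ∈ P.full then 1 else 0) + P.top (K + 1) := rfl
    rw [sum_range_succ, ih, sum_range_succ _ K, sum_range_succ f K, top_eq, hlow]
    push_cast
    ring

end RowSums

theorem sum_range_succ_ite_dvd_two_one (m y : ℕ) :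
    ∑ z ∈ range (y + 1), (if m ∣ z ∧ z ≠ 0 then 2 else 1) = y + y / m + 1 := by
  induction y with
  | zero => simp
  | succ y ih => rw [sum_range_succ, ih, Nat.succ_div]; split_ifs <;> grind

theorem sum_range_succ_ite_dvd_two_zero (m y : ℕ) :
    ∑ z ∈ range (y + 1), (if z = 0 then 1 else if m ∣ z then 2 else 0) = 2 * (y / m) + 1 := by
  induction y with
  | zero => simp
  | succ y ih => rw [sum_range_succ, ih, Nat.succ_div]; split_ifs <;> grind

theorem sum_rowCount_true (y : ℕ) :
    P.rowCount (fun _ => True) y .square + P.rowCount (fun _ => True) y .upper +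
      P.rowCount (fun _ => True) y .lower =
      (if (n - 2) ∣ y ∧ y ≠ 0 then 2 else 1) * P.low y + (P.half y).natAbs := by
  simp only [rowCount, mem_pattern_square, mem_pattern_upper, mem_pattern_lower, filter_true,
    card_range, reduceCtorEq, and_false, and_true, not_false_eq_true]
  by_cases hdvd : (n - 2) ∣ y
  · obtain rfl | hy0 := eq_or_ne y 0
    · simp [row_of_half_eq_zero P.half_zero, P.half_zero]
    · rw [← natAbs_tilt]
      simp only [hdvd, hy0, row, Shape.part, not_true_eq_false, not_false_eq_true, if_true,
        if_false, true_and, ne_eq]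
      omega
  · simp [hdvd, P.half_of_not_dvd y hdvd, row_square]

variable {P} in
theorem whites_wall (hH : P.IsBound H) : whites P.wall = ∑ y ∈ range H,
    ((if y ∈ P.full then 1 else 0) * (y + y / (n - 2) + 1) +
      (P.half y).natAbs * (y + y / (n - 2))) := by
  have hcount := ncard_white_eq_sum hH fun _ => True
  simp only [and_true] at hcount
  rw [whites, hcount, sum_congr rfl fun y _ => P.sum_rowCount_true y, sum_add_distrib]
  have hlow := sum_mul_low (fun y => if (n - 2) ∣ y ∧ y ≠ 0 then 2 else 1) hH
  simp only [Nat.cast_id] at hlow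
  rw [hlow, ← sum_add_distrib]
  refine sum_congr rfl fun y _ => ?_
  rw [sum_range_succ_ite_dvd_two_one, add_assoc]
  congr 1
  by_cases hdvd : (n - 2) ∣ y
  · obtain _ | y := y
    · simp [P.half_zero]
    · rw [sum_range_succ_ite_dvd_two_one, Nat.succ_div_of_dvd hdvd]
      ring
  · simp [P.half_of_not_dvd y hdvd]

variable {P} in
theorem wt_zero_wall (hn : 4 ≤ n) (hH : P.IsBound H) : wt n P.wall 0 = ∑ y ∈ range H,
    if y % (2 * n - 4) = 0 then
      (P.row y .upper + 1) / 2 + if y = 0 then 0 else P.row y .lower / 2 else 0 := by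
  rw [wt, ncard_white_eq_sum hH]
  refine sum_congr rfl fun y _ => ?_
  simp only [rowCount, label_eq_zero_iff hn, Block.halfIndex]
  by_cases hy : y % (2 * n - 4) = 0
  · have hdvd := (dvd_iff_mod_period hn y).2 (Or.inl hy)
    simp only [mem_pattern_square, mem_pattern_upper, mem_pattern_lower, hdvd, hy, reduceCtorEq,
      and_false, and_true, not_false_eq_true, not_true_eq_false, true_and, if_true,
      if_false, zero_add, card_range_filter_even, card_range_filter_odd]
    by_cases hy0 : y = 0 <;> simp [hy0]
  · simp [hy]

end Profile

/-- The first fermionic part of a signed number `D` of columns that end in a single half-block with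
label `0` or `1`: whether `D` is positive. -/
def signBit (D : ℤ) : ℕ := if 0 < D then 1 else 0

/-- The second fermionic part, which is chosen so that `|D| - parityBit D - signBit D` is even and
nonnegative. -/
def parityBit (D : ℤ) : ℕ := if D ≠ 0 ∧ (0 < D ↔ D % 2 = 0) then 1 else 0

/-- The bosonic part. -/
def bosonPart (D : ℤ) : ℕ := (D.natAbs - parityBit D - signBit D) / 2

/-- The integer with the given parity bit, sign bit and bosonic part. -/
def ofBits (p s : Bool) (j : ℕ) : ℤ := (if s then 1 else -1) * (2 * j + p.toNat + s.toNat)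

theorem natAbs_eq_bits (D : ℤ) : D.natAbs = 2 * bosonPart D + parityBit D + signBit D := by
  unfold bosonPart parityBit signBit
  split_ifs <;> omega

theorem bits_injective {D D' : ℤ} (hparity : parityBit D = parityBit D')
    (hsign : signBit D = signBit D') (hboson : bosonPart D = bosonPart D') : D = D' := by
  have hD := natAbs_eq_bits D
  have hD' := natAbs_eq_bits D'
  unfold parityBit signBit at *
  split_ifs at * <;> omega

theorem signBit_ofBits (p s : Bool) (j : ℕ) : signBit (ofBits p s j) = s.toNat := by
  cases p <;> cases s <;> simp [signBit, ofBits] <;> omega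

theorem parityBit_ofBits (p s : Bool) (j : ℕ) : parityBit (ofBits p s j) = p.toNat := by
  cases p <;> cases s <;> simp [parityBit, ofBits] <;> omega

theorem bosonPart_ofBits (p s : Bool) (j : ℕ) : bosonPart (ofBits p s j) = j := by
  have habs := natAbs_eq_bits (ofBits p s j)
  have hofBits : (ofBits p s j).natAbs = 2 * j + p.toNat + s.toNat := by
    cases p <;> cases s <;> simp [ofBits] <;> omega
  rw [signBit_ofBits, parityBit_ofBits] at habs
  omega

/-- The contribution of the columns ending in a half-block at level `y` to twice the `0`-weight. -/
def halfWeight (n y : ℕ) (D : ℤ) : ℤ :=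
  if y % (2 * n - 4) = 0 then 2 * (y / (2 * n - 4) : ℕ) * D.natAbs + signBit D - parityBit D
  else (2 * (y / (2 * n - 4) : ℕ) + 1) * D.natAbs

theorem halfWeight_zero (n y : ℕ) : halfWeight n y 0 = 0 := by
  simp [halfWeight, signBit, parityBit]

namespace Profile

variable {n : ℕ} (P : Profile n) {H : ℕ}

theorem two_mul_row_halves (y : ℕ) :
    2 * ((P.row y .upper + 1) / 2 + P.row y .lower / 2) + parityBit (P.half y) =
      2 * P.low y + (P.half y).natAbs + signBit (P.half y) := by
  have htilt := P.tilt_eq_or y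
  simp only [row, Shape.part, parityBit, signBit]
  split_ifs <;> omega

theorem two_mul_wt_zero_level (y : ℕ) :
    (2 * ((if y % (2 * n - 4) = 0 then
      (P.row y .upper + 1) / 2 + if y = 0 then 0 else P.row y .lower / 2 else 0 : ℕ)) : ℤ) =
    (if y = 0 then P.top 0 % 2 else 0 : ℕ) +
      ((if y = 0 then 1 else if (2 * n - 4) ∣ y then 2 else 0 : ℕ) * P.low y +
        if (2 * n - 4) ∣ y then
          ((P.half y).natAbs + signBit (P.half y) - parityBit (P.half y) : ℤ) else 0) := by
  obtain rfl | hy0 := eq_or_ne y 0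
  · simp only [Nat.zero_mod, row_of_half_eq_zero P.half_zero, dvd_zero, P.half_zero,
      top_of_half_eq_zero P.half_zero, signBit, parityBit, add_zero,
      Int.natCast_ediv, Nat.cast_add, Nat.cast_one, Nat.cast_ofNat, Int.natCast_emod, one_mul,
      Int.natAbs_zero, Nat.cast_zero, lt_self_iff_false, ne_eq, not_true_eq_false,
      EuclideanDomain.zero_mod, iff_true, ↓reduceIte, and_self, sub_self]
    omega
  · have hrow := P.two_mul_row_halves y
    simp only [hy0, if_false, Nat.dvd_iff_mod_eq_zero]
    split_ifs <;> omega

theorem natAbs_half_mul_add_eq_halfWeight (y : ℕ) :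
    (P.half y).natAbs *
      (∑ z ∈ range y, if z = 0 then 1 else if (2 * n - 4) ∣ z then 2 else 0 : ℕ) +
      (if (2 * n - 4) ∣ y then
        ((P.half y).natAbs + signBit (P.half y) - parityBit (P.half y) : ℤ) else 0) =
    halfWeight n y (P.half y) := by
  obtain _ | y := y
  · simp [P.half_zero, halfWeight_zero, signBit, parityBit]
  · rw [sum_range_succ_ite_dvd_two_zero, halfWeight, Nat.succ_div]
    simp only [← Nat.dvd_iff_mod_eq_zero]
    split_ifs
    all_goals
      push_cast
      ring

variable {P} in
theorem two_mul_wt_zero (hn : 4 ≤ n) (hH : P.IsBound H) :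
    (2 * wt n P.wall 0 : ℤ) = (P.top 0 % 2 : ℕ) + ∑ y ∈ range H,
      ((if y ∈ P.full then 1 else 0) * (2 * (y / (2 * n - 4) : ℕ) + 1) +
        halfWeight n y (P.half y)) := by
  have hH' := hH.mono H.le_succ
  have hlow := sum_mul_low (R := ℤ)
    (fun y => (if y = 0 then 1 else if (2 * n - 4) ∣ y then 2 else 0 : ℕ)) hH'
  simp only [← Nat.cast_sum] at hlow
  rw [wt_zero_wall hn hH', Nat.cast_sum, mul_sum,
    sum_congr rfl fun y _ => P.two_mul_wt_zero_level y, sum_add_distrib, sum_add_distrib, hlow,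
    ← Nat.cast_sum, sum_ite_eq' (range (H + 1)), if_pos (by simp), ← sum_add_distrib]
  simp only [add_assoc, natAbs_half_mul_add_eq_halfWeight, sum_range_succ_ite_dvd_two_zero]
  simp [sum_range_succ, hH H le_rfl, halfWeight_zero]

end Profile

/-! ### Layers -/

/-- A layer of the combinatorial type of a Young wall: the set of its fermions, and the charge and
the number of the bosons that come from its half-blocks. -/
@[ext] structure Layer where
  fermions : Finset ℕ
  charge : ℤ
  bosons : ℕ
  deriving DecidableEq

/-- The contribution of the `a`-th layer of a wall to twice its `0`-weight. -/
def Layer.weight (x : Layer) (a : ℕ) : ℕ :=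
  (2 * a + 1) * (#x.fermions + x.charge.natAbs) + 4 * (a + 1) * x.bosons

theorem mul_add_div_period {n a b : ℕ} (hb : b < 2 * n - 4) :
    (a * (2 * n - 4) + b) / (2 * n - 4) = a := by
  rw [mul_comm, Nat.mul_add_div (by omega), Nat.div_eq_of_lt hb, add_zero]

namespace Profile

variable {n : ℕ} (P : Profile n)

/-- The `a`-th layer, which describes the columns that end at the levels from `a * (2 * n - 4)` to
`(a + 1) * (2 * n - 4)`. The half-blocks at a level that is divisible by `2 * n - 4` are shared by
two layers: their sign bit is the fermion `0` of the upper layer, their parity bit is the fermion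
`2 * n - 3` of the lower one. At the bottom the parity of the number of columns takes the place of
the sign bit. -/
def layer (a : ℕ) : Layer where
  fermions := {t ∈ range (2 * n - 2) |
    if t = 0 then (if a = 0 then P.top 0 % 2 = 1 else 0 < P.half (a * (2 * n - 4)))
    else if t = 2 * n - 3 then parityBit (P.half ((a + 1) * (2 * n - 4))) = 1
    else a * (2 * n - 4) + (t - 1) ∈ P.full}
  charge := P.half (a * (2 * n - 4) + (n - 2))
  bosons := bosonPart (P.half ((a + 1) * (2 * n - 4)))

theorem layer_fermions_subset (a : ℕ) : (P.layer a).fermions ⊆ range (2 * n - 2) :=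
  filter_subset _ _

theorem zero_mem_layer_zero (hn : 4 ≤ n) : 0 ∈ (P.layer 0).fermions ↔ P.top 0 % 2 = 1 := by
  simp only [layer, mem_filter, mem_range, if_true, and_iff_right_iff_imp]
  omega

theorem zero_mem_layer_succ (hn : 4 ≤ n) (a : ℕ) :
    0 ∈ (P.layer (a + 1)).fermions ↔ 0 < P.half ((a + 1) * (2 * n - 4)) := by
  simp only [layer, mem_filter, mem_range, if_true, a.succ_ne_zero, if_false,
    and_iff_right_iff_imp]
  omega

theorem succ_mem_layer {b : ℕ} (hb : b < 2 * n - 4) (a : ℕ) :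
    b + 1 ∈ (P.layer a).fermions ↔ a * (2 * n - 4) + b ∈ P.full := by
  simp only [layer, mem_filter, mem_range, b.succ_ne_zero, if_false,
    show b + 1 ≠ 2 * n - 3 by omega, Nat.add_sub_cancel, and_iff_right_iff_imp]
  omega

theorem last_mem_layer (hn : 4 ≤ n) (a : ℕ) :
    2 * n - 3 ∈ (P.layer a).fermions ↔ parityBit (P.half ((a + 1) * (2 * n - 4))) = 1 := by
  simp only [layer, mem_filter, mem_range, show 2 * n - 3 ≠ 0 by omega, if_false, if_true,
    and_iff_right_iff_imp]
  omega

theorem sum_layer_fermions (hn : 4 ≤ n) {R : Type*} [CommRing R] (c : ℕ → R) (a : ℕ) :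
    ∑ t ∈ (P.layer a).fermions, c t =
      (if 0 ∈ (P.layer a).fermions then 1 else 0) * c 0 +
      ∑ b ∈ range (2 * n - 4), (if a * (2 * n - 4) + b ∈ P.full then 1 else 0) * c (b + 1) +
      parityBit (P.half ((a + 1) * (2 * n - 4))) * c (2 * n - 3) := by
  have hparity : (parityBit (P.half ((a + 1) * (2 * n - 4))) : R) =
      if 2 * n - 3 ∈ (P.layer a).fermions then 1 else 0 := by
    rw [if_congr (P.last_mem_layer hn a) rfl rfl, parityBit]
    split_ifs <;> simp_all
  have hfull : ∀ b ∈ range (2 * n - 4),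
      (if a * (2 * n - 4) + b ∈ P.full then 1 else 0) * c (b + 1) =
        if b + 1 ∈ (P.layer a).fermions then c (b + 1) else 0 := fun b hb => by
    rw [if_congr (P.succ_mem_layer (mem_range.1 hb) a) rfl rfl, ite_mul, one_mul, zero_mul]
  have hsum : ∑ t ∈ (P.layer a).fermions, c t =
      ∑ t ∈ range (2 * n - 2), if t ∈ (P.layer a).fermions then c t else 0 := by
    rw [sum_ite_mem, inter_eq_right.2 (P.layer_fermions_subset a)]
  rw [hsum, hparity, sum_congr rfl hfull, show 2 * n - 2 = 2 * n - 4 + 1 + 1 by omega,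
    sum_range_succ, sum_range_succ', show 2 * n - 4 + 1 = 2 * n - 3 by omega]
  simp only [ite_mul, one_mul, zero_mul]
  ring

theorem ite_zero_mem_layer_succ (hn : 4 ≤ n) {R : Type*} [CommRing R] (a : ℕ) :
    (if 0 ∈ (P.layer (a + 1)).fermions then 1 else 0 : R) =
      signBit (P.half ((a + 1) * (2 * n - 4))) := by
  rw [if_congr (P.zero_mem_layer_succ hn a) rfl rfl, signBit, Nat.cast_ite, Nat.cast_one,
    Nat.cast_zero]

theorem ite_zero_mem_layer_zero (hn : 4 ≤ n) {R : Type*} [CommRing R] :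
    (if 0 ∈ (P.layer 0).fermions then 1 else 0 : R) = (P.top 0 % 2 : ℕ) := by
  rw [if_congr (P.zero_mem_layer_zero hn) rfl rfl]
  obtain h | h := Nat.mod_two_eq_zero_or_one (P.top 0) <;> simp [h]

section Regrouping

variable {R : Type*} [CommRing R] {F : ℕ → R} {G : ℕ → ℤ → R} {c : ℕ → ℕ → R} {u v : ℕ → R}

theorem sum_period (hn : 4 ≤ n) (hF : ∀ a, ∀ b < 2 * n - 4, F (a * (2 * n - 4) + b) = c a (b + 1))
    (hG : ∀ y, G y 0 = 0) (hmid : ∀ a D, G (a * (2 * n - 4) + (n - 2)) D = D.natAbs * v a) (a : ℕ) :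
    ∑ b ∈ range (2 * n - 4), ((if a * (2 * n - 4) + b ∈ P.full then 1 else 0) *
        F (a * (2 * n - 4) + b) + G (a * (2 * n - 4) + b) (P.half (a * (2 * n - 4) + b))) =
      ∑ b ∈ range (2 * n - 4), (if a * (2 * n - 4) + b ∈ P.full then 1 else 0) * c a (b + 1) +
      (G (a * (2 * n - 4)) (P.half (a * (2 * n - 4))) +
        (P.half (a * (2 * n - 4) + (n - 2))).natAbs * v a) := by
  have hhalf : ∀ b ∈ range (2 * n - 4), b ≠ 0 ∧ b ≠ n - 2 →
      G (a * (2 * n - 4) + b) (P.half (a * (2 * n - 4) + b)) = 0 := by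
    rintro b hb ⟨hb0, hb2⟩
    rw [P.half_of_not_dvd, hG]
    rw [dvd_iff_mod_period hn, Nat.mul_add_mod', Nat.mod_eq_of_lt (mem_range.1 hb)]
    tauto
  rw [sum_add_distrib, sum_congr rfl fun b hb => by rw [hF a b (mem_range.1 hb)],
    sum_eq_add 0 (n - 2) (by omega) hhalf (by simp; omega) (by simp; omega), hmid, add_zero]

/-- The term for the half-blocks at the upper end is the part of the next level that belongs to
layer `A`. -/
theorem sum_levels_add_eq_sum_layers (hn : 4 ≤ n)
    (hF : ∀ a, ∀ b < 2 * n - 4, F (a * (2 * n - 4) + b) = c a (b + 1)) (hG : ∀ y, G y 0 = 0)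
    (hlow : ∀ a D, G ((a + 1) * (2 * n - 4)) D =
      signBit D * c (a + 1) 0 + parityBit D * c a (2 * n - 3) + bosonPart D * u a)
    (hmid : ∀ a D, G (a * (2 * n - 4) + (n - 2)) D = D.natAbs * v a) (A : ℕ) :
    (P.top 0 % 2 : ℕ) * c 0 0 + ∑ y ∈ range ((A + 1) * (2 * n - 4)),
        ((if y ∈ P.full then 1 else 0) * F y + G y (P.half y)) +
      (parityBit (P.half ((A + 1) * (2 * n - 4))) * c A (2 * n - 3) +
        bosonPart (P.half ((A + 1) * (2 * n - 4))) * u A) =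
    ∑ a ∈ range (A + 1), (∑ t ∈ (P.layer a).fermions, c a t +
      (P.layer a).charge.natAbs * v a + (P.layer a).bosons * u a) := by
  have hperiod := P.sum_period hn hF hG hmid
  induction A with
  | zero =>
    have hbottom := hperiod 0
    simp only [zero_mul, zero_add, P.half_zero, hG] at hbottom
    rw [sum_range_one, sum_layer_fermions P hn, ite_zero_mem_layer_zero P hn, zero_add, one_mul,
      hbottom, layer]
    simp only [zero_mul, zero_add, one_mul]
    ring
  | succ A ih =>
    rw [sum_range_succ _ (A + 1), ← ih, Nat.succ_mul (A + 1), sum_range_add, hperiod, hlow,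
      sum_layer_fermions P hn, ite_zero_mem_layer_succ P hn, layer]
    simp only [Nat.succ_mul (A + 1)]
    ring

variable {P} in
theorem sum_levels_eq_sum_layers (hn : 4 ≤ n)
    (hF : ∀ a, ∀ b < 2 * n - 4, F (a * (2 * n - 4) + b) = c a (b + 1)) (hG : ∀ y, G y 0 = 0)
    (hlow : ∀ a D, G ((a + 1) * (2 * n - 4)) D =
      signBit D * c (a + 1) 0 + parityBit D * c a (2 * n - 3) + bosonPart D * u a)
    (hmid : ∀ a D, G (a * (2 * n - 4) + (n - 2)) D = D.natAbs * v a) {A : ℕ}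
    (hA : P.IsBound ((A + 1) * (2 * n - 4))) :
    (P.top 0 % 2 : ℕ) * c 0 0 + ∑ y ∈ range ((A + 1) * (2 * n - 4)),
        ((if y ∈ P.full then 1 else 0) * F y + G y (P.half y)) =
    ∑ a ∈ range (A + 1), (∑ t ∈ (P.layer a).fermions, c a t +
      (P.layer a).charge.natAbs * v a + (P.layer a).bosons * u a) := by
  rw [← P.sum_levels_add_eq_sum_layers hn hF hG hlow hmid, (hA _ le_rfl).2]
  simp [parityBit, bosonPart, signBit]

end Regrouping

variable {P} in
theorem two_mul_wt_zero_eq_sum_layers (hn : 4 ≤ n) {A : ℕ}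
    (hA : P.IsBound ((A + 1) * (2 * n - 4))) :
    2 * wt n P.wall 0 = ∑ a ∈ range (A + 1), (P.layer a).weight a := by
  have hregroup := sum_levels_eq_sum_layers (P := P) (R := ℤ)
    (F := fun y => 2 * (y / (2 * n - 4) : ℕ) + 1) (G := halfWeight n)
    (c := fun a _ => 2 * a + 1) (u := fun a => 4 * (a + 1)) (v := fun a => 2 * a + 1) hn
    (fun a b hb => by rw [mul_add_div_period hb]) (halfWeight_zero n)
    (fun a D => by
      rw [halfWeight, Nat.mul_mod_left, if_pos rfl, Nat.mul_div_cancel _ (by omega),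
        natAbs_eq_bits]
      push_cast
      ring)
    (fun a D => by
      rw [halfWeight, Nat.mul_add_mod', Nat.mod_eq_of_lt (by omega), if_neg (by omega),
        mul_add_div_period (by omega), mul_comm]) hA
  zify
  rw [two_mul_wt_zero hn hA]
  simp only [CharP.cast_eq_zero, mul_zero, zero_add, mul_one] at hregroup
  rw [hregroup]
  refine sum_congr rfl fun a _ => ?_
  rw [Layer.weight, sum_const, nsmul_eq_mul]
  push_cast
  ring

end Profile

/-- The exponent of the root of unity by which the fermion `t` of a layer is counted. For
`t < 2 * n - 2` the exponents run through the nonzero residues modulo `2 * n - 1`. -/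
def rootExp (n t : ℕ) : ℕ := n + t + if t ≤ n - 2 then 0 else 1

section Congruence

variable {n : ℕ}

theorem two_mul_eq_one_zmod (hn : 4 ≤ n) : (2 * n : ZMod (2 * n - 1)) = 1 := by
  have hself := ZMod.natCast_self (2 * n - 1)
  rw [Nat.cast_sub (by omega)] at hself
  push_cast at hself
  linear_combination hself

theorem period_eq_neg_three_zmod (hn : 4 ≤ n) : ((2 * n - 4 : ℕ) : ZMod (2 * n - 1)) = -3 := by
  rw [Nat.cast_sub (by omega)]
  push_cast
  linear_combination two_mul_eq_one_zmod hn

theorem mul_period_add_div (hn : 4 ≤ n) (a b : ℕ) :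
    (a * (2 * n - 4) + b) / (n - 2) = 2 * a + b / (n - 2) := by
  rw [show a * (2 * n - 4) + b = (n - 2) * (2 * a) + b by
    rw [show 2 * n - 4 = 2 * (n - 2) by omega]; ring, Nat.mul_add_div (by omega)]

theorem fullColumn_eq_rootExp_zmod (hn : 4 ≤ n) {a b : ℕ} (hb : b < 2 * n - 4) :
    ((a * (2 * n - 4) + b + (a * (2 * n - 4) + b) / (n - 2) + 1 : ℕ) +
      n * (2 * ((a * (2 * n - 4) + b) / (2 * n - 4) : ℕ) + 1) : ZMod (2 * n - 1)) =
    rootExp n (b + 1) := by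
  have hdiv : b / (n - 2) = if b + 1 ≤ n - 2 then 0 else 1 := by
    split_ifs with h
    · exact Nat.div_eq_of_lt (by omega)
    · exact Nat.div_eq_of_lt_le (by omega) (by omega)
  rw [mul_add_div_period hb, mul_period_add_div hn, hdiv, rootExp]
  push_cast
  rw [period_eq_neg_three_zmod hn]
  linear_combination (a : ZMod (2 * n - 1)) * two_mul_eq_one_zmod hn

theorem lowHalf_eq_rootExp_zmod (hn : 4 ≤ n) (a : ℕ) (D : ℤ) :
    ((D.natAbs * ((a + 1) * (2 * n - 4) + (a + 1) * (2 * n - 4) / (n - 2)) : ℕ) +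
      n * halfWeight n ((a + 1) * (2 * n - 4)) D : ZMod (2 * n - 1)) =
    signBit D * rootExp n 0 + parityBit D * rootExp n (2 * n - 3) := by
  have hdiv : (a + 1) * (2 * n - 4) / (n - 2) = 2 * (a + 1) := by
    simpa using mul_period_add_div hn (a + 1) 0
  have hlast : ((2 * n - 3 : ℕ) : ZMod (2 * n - 1)) = -2 := by
    rw [Nat.cast_sub (by omega)]
    push_cast
    linear_combination two_mul_eq_one_zmod hn
  rw [halfWeight, Nat.mul_mod_left, if_pos rfl, Nat.mul_div_cancel _ (by omega), hdiv,
    natAbs_eq_bits, rootExp, rootExp, if_pos (by omega), if_neg (by omega)]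
  push_cast
  rw [hlast, period_eq_neg_three_zmod hn]
  linear_combination ((2 * bosonPart D + parityBit D + signBit D) * (a + 1) - parityBit D :
    ZMod (2 * n - 1)) * two_mul_eq_one_zmod hn

theorem midHalf_eq_zero_zmod (hn : 4 ≤ n) (a : ℕ) (D : ℤ) :
    ((D.natAbs * (a * (2 * n - 4) + (n - 2) + (a * (2 * n - 4) + (n - 2)) / (n - 2)) : ℕ) +
      n * halfWeight n (a * (2 * n - 4) + (n - 2)) D : ZMod (2 * n - 1)) = 0 := by
  have hmid : ((n - 2 : ℕ) : ZMod (2 * n - 1)) = n - 2 := by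
    rw [Nat.cast_sub (by omega)]
    norm_num
  rw [halfWeight, Nat.mul_add_mod', Nat.mod_eq_of_lt (by omega), if_neg (by omega),
    mul_add_div_period (by omega), mul_period_add_div hn, Nat.div_self (by omega)]
  generalize D.natAbs = m
  push_cast
  rw [hmid, period_eq_neg_three_zmod hn]
  linear_combination (m * (a + 1) : ZMod (2 * n - 1)) * two_mul_eq_one_zmod hn

namespace Profile

variable {P : Profile n}

/-- The substitution `q₀ = ξ² q`, `q₁ = ⋯ = qₙ = ξ` gives the wall the coefficient
`ξ ^ (whites + wt₀)`. Modulo `2n - 1`, where `2` is invertible with inverse `n`, this exponent is a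
sum over levels, as twice the `0`-weight is. -/
theorem whites_add_wt_zero_modEq (hn : 4 ≤ n) {A : ℕ} (hA : P.IsBound ((A + 1) * (2 * n - 4))) :
    whites P.wall + wt n P.wall 0 ≡
      ∑ a ∈ range (A + 1), ∑ t ∈ (P.layer a).fermions, rootExp n t [MOD 2 * n - 1] := by
  have hregroup := sum_levels_eq_sum_layers (P := P) (R := ZMod (2 * n - 1))
    (F := fun y => (y + y / (n - 2) + 1 : ℕ) + n * (2 * (y / (2 * n - 4) : ℕ) + 1))
    (G := fun y D => (D.natAbs * (y + y / (n - 2)) : ℕ) + n * halfWeight n y D)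
    (c := fun _ t => rootExp n t) (u := fun _ => 0) (v := fun _ => 0) hn
    (fun a b hb => fullColumn_eq_rootExp_zmod hn hb) (fun y => by simp [halfWeight_zero])
    (fun a D => by rw [lowHalf_eq_rootExp_zmod hn, mul_zero, add_zero])
    (fun a D => by rw [midHalf_eq_zero_zmod hn, mul_zero]) hA
  have hwt : (wt n P.wall 0 : ZMod (2 * n - 1)) = n * (2 * wt n P.wall 0 : ℤ) := by
    push_cast
    linear_combination (-(wt n P.wall 0 : ZMod (2 * n - 1))) * two_mul_eq_one_zmod hn
  rw [← ZMod.natCast_eq_natCast_iff, Nat.cast_add, hwt, two_mul_wt_zero hn hA, whites_wall hA]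
  simp only [Nat.cast_sum, Int.cast_add, Int.cast_sum, Int.cast_natCast]
  simp only [mul_zero, add_zero] at hregroup
  rw [← hregroup, mul_add, mul_sum, add_left_comm, ← sum_add_distrib]
  congr 1
  · simp [rootExp, mul_comm]
  · refine sum_congr rfl fun y _ => ?_
    generalize y / (2 * n - 4) = a
    push_cast
    ring

end Profile

end Congruence

theorem forall_mod_eq_iff {m r : ℕ} (hr : r < m) {p : ℕ → Prop} :
    (∀ y, y % m = r → p y) ↔ ∀ a, p (a * m + r) := by
  refine ⟨fun h a => h _ (by rw [Nat.mul_add_mod', Nat.mod_eq_of_lt hr]), fun h y hy => ?_⟩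
  rw [← Nat.div_add_mod' y m, hy]
  exact h _

theorem eq_of_erase_eq {α : Type*} [DecidableEq α] {s t : Finset α} {x : α}
    (herase : s.erase x = t.erase x) (hcard : #s % 2 = #t % 2) : s = t := by
  have hs := card_erase_add_one (s := s) (a := x)
  have ht := card_erase_add_one (s := t) (a := x)
  rw [herase] at hs
  by_cases hxs : x ∈ s <;> by_cases hxt : x ∈ t
  · rw [← insert_erase hxs, herase, insert_erase hxt]
  · have := hs hxs
    rw [erase_eq_of_notMem hxt] at this
    omega
  · have := ht hxt
    rw [← herase, erase_eq_of_notMem hxs] at this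
    omega
  · rwa [erase_eq_of_notMem hxs, erase_eq_of_notMem hxt] at herase

theorem parityBit_eq_one {D : ℤ} : parityBit D = 1 ↔ D ≠ 0 ∧ (0 < D ↔ D % 2 = 0) := by
  simp [parityBit]

theorem bosonPart_zero : bosonPart 0 = 0 := rfl

/-- The layers of distinguished `0`-generated walls. -/
def Layer.IsAllowed (n : ℕ) (x : Layer) : Prop :=
  (∀ t ∈ x.fermions, t + 1 < 2 * n - 2 → t + 1 ∈ x.fermions) ∧
    (n - 2 ∈ x.fermions → x.charge = 0) ∧
    (x.charge ≠ 0 → n - 1 ∈ x.fermions ∧ n - 1 < x.charge.natAbs)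

instance (n : ℕ) : DecidablePred (Layer.IsAllowed n) := fun x =>
  inferInstanceAs (Decidable ((∀ t ∈ x.fermions, t + 1 < 2 * n - 2 → t + 1 ∈ x.fermions) ∧
    (n - 2 ∈ x.fermions → x.charge = 0) ∧
    (x.charge ≠ 0 → n - 1 ∈ x.fermions ∧ n - 1 < x.charge.natAbs)))

/-- The empty layer. -/
instance : Zero Layer := ⟨⟨∅, 0, 0⟩⟩

theorem Layer.fermions_zero : (0 : Layer).fermions = ∅ := rfl

theorem Layer.charge_zero : (0 : Layer).charge = 0 := rfl

theorem Layer.bosons_zero : (0 : Layer).bosons = 0 := rfl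

theorem Layer.isAllowed_zero (n : ℕ) : (0 : Layer).IsAllowed n :=
  ⟨fun _ ht => absurd ht (notMem_empty _), fun _ => rfl, fun h => absurd rfl h⟩

theorem Layer.weight_zero (a : ℕ) : (0 : Layer).weight a = 0 := rfl

theorem Layer.eq_zero_of_weight_le {x : Layer} {a : ℕ} (h : x.weight a ≤ 2 * a) : x = 0 := by
  unfold weight at h
  have hsize : #x.fermions + x.charge.natAbs = 0 := by
    by_contra hne
    have := Nat.mul_le_mul_left (2 * a + 1) (Nat.one_le_iff_ne_zero.2 hne)
    omega
  have hbosons : x.bosons = 0 := by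
    by_contra hne
    have := Nat.mul_le_mul_left (4 * (a + 1)) (Nat.one_le_iff_ne_zero.2 hne)
    omega
  exact Layer.ext (card_eq_zero.1 (by omega)) (Int.natAbs_eq_zero.1 (by omega)) hbosons

namespace Profile

variable {n : ℕ}

section Distinguished

variable (P : Profile n)

theorem isDistinguished_wall_iff_periods (hn : 4 ≤ n) : IsDistinguished n P.wall ↔
    (∀ a, (P.half (a * (2 * n - 4) + (n - 2)) ≠ 0 → a * (2 * n - 4) + (n - 2) ∈ P.full ∧
        n - 1 < (P.half (a * (2 * n - 4) + (n - 2))).natAbs) ∧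
      (a * (2 * n - 4) + (n - 3) ∈ P.full → P.half (a * (2 * n - 4) + (n - 2)) = 0 ∧
        a * (2 * n - 4) + (n - 2) ∈ P.full)) ∧
    (∀ a b, b + 1 < 2 * n - 4 → b + 1 ≠ n - 2 → a * (2 * n - 4) + b ∈ P.full →
      a * (2 * n - 4) + (b + 1) ∈ P.full) ∧
    (∀ a, (a * (2 * n - 4) + (2 * n - 5) ∈ P.full →
        parityBit (P.half ((a + 1) * (2 * n - 4))) = 1) ∧
      (0 < P.half ((a + 1) * (2 * n - 4)) → (a + 1) * (2 * n - 4) ∈ P.full)) ∧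
    (0 ∉ P.full → P.top 0 % 2 = 0) := by
  rw [P.isDistinguished_wall_iff hn, forall_mod_eq_iff (by omega)]
  refine and_congr (forall_congr' fun a => ?_) (and_congr ?_ (and_congr_left' ?_))
  · rw [show a * (2 * n - 4) + (n - 2) - 1 = a * (2 * n - 4) + (n - 3) by omega]
  · refine ⟨fun h a b hb hmid => h (a * (2 * n - 4) + (b + 1)) ?_, fun h y hy hpred => ?_⟩
    · rw [dvd_iff_mod_period hn, Nat.mul_add_mod', Nat.mod_eq_of_lt hb]
      omega
    · rw [dvd_iff_mod_period hn, not_or] at hy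
      have hdiv := Nat.div_add_mod' y (2 * n - 4)
      have hstep := h (y / (2 * n - 4)) (y % (2 * n - 4) - 1)
      rw [Nat.sub_add_cancel (by omega), hdiv,
        show y / (2 * n - 4) * (2 * n - 4) + (y % (2 * n - 4) - 1) = y - 1 by omega] at hstep
      exact hstep (Nat.mod_lt _ (by omega)) hy.2 hpred
  · rw [forall_congr' fun y => forall_comm (p := fun _ : y ≠ 0 => fun _ => _)]
    rw [forall_mod_eq_iff (by omega), ← Nat.and_forall_add_one]
    simp only [parityBit_eq_one, zero_mul, add_zero, ne_eq, not_true_eq_false, false_imp_iff,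
      true_and]
    refine forall_congr' fun a => ?_
    rw [show (a + 1) * (2 * n - 4) - 1 = a * (2 * n - 4) + (2 * n - 5) by
      rw [Nat.succ_mul]; omega]
    exact imp_iff_right (Nat.mul_ne_zero a.succ_ne_zero (by omega))

theorem forall_mem_layer_succ_mem_iff (hn : 4 ≤ n) (a : ℕ) :
    (∀ t ∈ (P.layer a).fermions, t + 1 < 2 * n - 2 → t + 1 ∈ (P.layer a).fermions) ↔
      (0 ∈ (P.layer a).fermions → a * (2 * n - 4) ∈ P.full) ∧
      (∀ b, b + 1 < 2 * n - 4 → a * (2 * n - 4) + b ∈ P.full →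
        a * (2 * n - 4) + (b + 1) ∈ P.full) ∧
      (a * (2 * n - 4) + (2 * n - 5) ∈ P.full →
        parityBit (P.half ((a + 1) * (2 * n - 4))) = 1) := by
  have hfirst := P.succ_mem_layer (b := 0) (by omega) a
  have hlast := P.succ_mem_layer (b := 2 * n - 5) (by omega) a
  rw [add_zero, zero_add] at hfirst
  rw [← hfirst, ← hlast, ← P.last_mem_layer hn]
  refine ⟨fun h => ⟨fun h0 => h 0 h0 (by omega), fun b hb => ?_, fun ht => ?_⟩, ?_⟩
  · rw [← P.succ_mem_layer (by omega), ← P.succ_mem_layer hb]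
    exact fun ht => h _ ht (by omega)
  · simpa [show 2 * n - 5 + 1 + 1 = 2 * n - 3 by omega] using h _ ht (by omega)
  · rintro ⟨hbottom, hstep, htop⟩ (_ | b) ht hlt
    · exact hbottom ht
    obtain hb | hb := lt_or_ge (b + 1) (2 * n - 4)
    · rw [P.succ_mem_layer hb]
      exact hstep b hb ((P.succ_mem_layer (by omega) a).1 ht)
    · obtain rfl : b = 2 * n - 5 := by omega
      simpa [show 2 * n - 5 + 1 + 1 = 2 * n - 3 by omega] using htop ht

theorem isDistinguished_iff_layers (hn : 4 ≤ n) :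
    IsDistinguished n P.wall ↔ ∀ a, (P.layer a).IsAllowed n := by
  have hmid : ∀ a, n - 2 ∈ (P.layer a).fermions ↔ a * (2 * n - 4) + (n - 3) ∈ P.full := fun a => by
    rw [← P.succ_mem_layer (by omega), show n - 3 + 1 = n - 2 by omega]
  have hmid' : ∀ a, n - 1 ∈ (P.layer a).fermions ↔ a * (2 * n - 4) + (n - 2) ∈ P.full := fun a => by
    rw [← P.succ_mem_layer (by omega), show n - 2 + 1 = n - 1 by omega]
  simp only [P.isDistinguished_wall_iff_periods hn, Layer.IsAllowed,
    P.forall_mem_layer_succ_mem_iff hn, hmid, hmid']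
  constructor
  · rintro ⟨hupper, hinner, hlower, hbottom⟩ a
    refine ⟨⟨fun h0 => ?_, fun b hb hfull => ?_, (hlower a).1⟩, fun h => ((hupper a).2 h).1,
      (hupper a).1⟩
    · obtain _ | a := a
      · rw [P.zero_mem_layer_zero hn] at h0
        rw [zero_mul]
        by_contra hnot
        have := hbottom hnot
        omega
      · exact (hlower a).2 ((P.zero_mem_layer_succ hn a).1 h0)
    · by_cases hb' : b = n - 3
      · subst hb'
        rw [show n - 3 + 1 = n - 2 by omega]
        exact ((hupper a).2 hfull).2
      · exact hinner a b hb (by omega) hfull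
  · intro h
    refine ⟨fun a => ⟨(h a).2.2, fun hfull => ⟨(h a).2.1 hfull, ?_⟩⟩,
      fun a b hb _ => (h a).1.2.1 b hb, fun a => ⟨(h a).1.2.2, fun hpos => ?_⟩, fun hnot => ?_⟩
    · simpa [show n - 3 + 1 = n - 2 by omega] using (h a).1.2.1 (n - 3) (by omega) hfull
    · exact (h (a + 1)).1.1 ((P.zero_mem_layer_succ hn a).2 hpos)
    · by_contra hodd
      have := (h 0).1.1 ((P.zero_mem_layer_zero hn).2 (by omega))
      rw [zero_mul] at this
      exact hnot this

end Distinguished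

section Layers

variable {P P' : Profile n}

theorem half_congr (hn : 4 ≤ n) {a : ℕ} (hlayer : P.layer a = P'.layer a)
    (hsucc : P.layer (a + 1) = P'.layer (a + 1)) :
    P.half ((a + 1) * (2 * n - 4)) = P'.half ((a + 1) * (2 * n - 4)) := by
  have hparity := P.last_mem_layer hn a
  have hsign := P.zero_mem_layer_succ hn a
  rw [hlayer, P'.last_mem_layer hn] at hparity
  rw [hsucc, P'.zero_mem_layer_succ hn] at hsign
  refine bits_injective ?_ (if_congr hsign.symm rfl rfl) (congrArg Layer.bosons hlayer)
  unfold parityBit at hparity ⊢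
  split_ifs at hparity ⊢ <;> simp_all

theorem level_congr (hn : 4 ≤ n) {y : ℕ}
    (hlayer : P.layer (y / (2 * n - 4)) = P'.layer (y / (2 * n - 4)))
    (hpred : P.layer (y / (2 * n - 4) - 1) = P'.layer (y / (2 * n - 4) - 1)) :
    (y ∈ P.full ↔ y ∈ P'.full) ∧ P.half y = P'.half y := by
  have hdiv := Nat.div_add_mod' y (2 * n - 4)
  have hlt : y % (2 * n - 4) < 2 * n - 4 := Nat.mod_lt _ (by omega)
  have hdvd := dvd_iff_mod_period hn y
  generalize y / (2 * n - 4) = a at *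
  generalize y % (2 * n - 4) = b at *
  refine ⟨?_, ?_⟩
  · rw [← hdiv, ← P.succ_mem_layer hlt, hlayer, P'.succ_mem_layer hlt]
  · by_cases hy : (n - 2) ∣ y
    · obtain rfl | rfl := hdvd.1 hy
      · rw [← hdiv, add_zero]
        obtain _ | a := a
        · rw [zero_mul, P.half_zero, P'.half_zero]
        · exact half_congr hn hpred hlayer
      · rw [← hdiv]
        exact congrArg Layer.charge hlayer
    · rw [P.half_of_not_dvd y hy, P'.half_of_not_dvd y hy]

theorem layer_injective (hn : 4 ≤ n) : Function.Injective (layer : Profile n → ℕ → Layer) :=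
  fun _ _ h => Profile.ext (Finset.ext fun _ => (level_congr hn (congrFun h _) (congrFun h _)).1)
    (Finsupp.ext fun _ => (level_congr hn (congrFun h _) (congrFun h _)).2)

/-- The type of the wall without white blocks. -/
instance : Zero (Profile n) := ⟨⟨∅, 0, rfl, fun _ _ => rfl⟩⟩

theorem layer_zero (a : ℕ) : (0 : Profile n).layer a = 0 := by
  refine Layer.ext (filter_false_of_mem fun t _ => ?_) rfl bosonPart_zero
  change ¬ if t = 0 then (if a = 0 then 0 % 2 = 1 else (0 : ℤ) < 0)
    else if t = 2 * n - 3 then parityBit 0 = 1 else a * (2 * n - 4) + (t - 1) ∈ (∅ : Finset ℕ)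
  simp [parityBit]

theorem isBound_of_layer_eq_zero (hn : 4 ≤ n) {k : ℕ} (h : ∀ a, k ≤ a → P.layer a = 0) :
    P.IsBound ((k + 1) * (2 * n - 4)) := by
  intro y hy
  have hdiv : k + 1 ≤ y / (2 * n - 4) := (Nat.le_div_iff_mul_le (by omega)).2 hy
  have hzero : ∀ a, k ≤ a → P.layer a = (0 : Profile n).layer a := fun a ha => by
    rw [h a ha, layer_zero]
  have hcongr := level_congr hn (hzero (y / (2 * n - 4)) (by omega)) (hzero _ (by omega))
  exact ⟨fun hfull => notMem_empty y (hcongr.1.1 hfull), hcongr.2⟩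

theorem layer_eq_zero (hn : 4 ≤ n) {a : ℕ} (ha : wt n P.wall 0 ≤ a) : P.layer a = 0 := by
  obtain ⟨H, hH⟩ := P.exists_isBound
  have hbound : P.IsBound ((H + a + 1) * (2 * n - 4)) :=
    hH.mono ((by omega : H ≤ H + a + 1).trans (Nat.le_mul_of_pos_right _ (by omega)))
  refine Layer.eq_zero_of_weight_le (a := a) (le_trans ?_ (Nat.mul_le_mul_left 2 ha))
  rw [two_mul_wt_zero_eq_sum_layers hn hbound]
  exact single_le_sum (f := fun a => (P.layer a).weight a) (fun _ _ => Nat.zero_le _)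
    (mem_range.2 (by omega))

theorem isBound_wt_zero (hn : 4 ≤ n) : P.IsBound ((wt n P.wall 0 + 1) * (2 * n - 4)) :=
  isBound_of_layer_eq_zero hn fun _ => layer_eq_zero hn

end Layers

section OfLayers

variable {g : ℕ → Layer} {k : ℕ}

/-- The number with sign of the columns that end in a single half-block at level `y`, as prescribed
by the layers `g`. -/
def layersHalf (n : ℕ) (g : ℕ → Layer) (y : ℕ) : ℤ :=
  if y = 0 then 0
  else if y % (2 * n - 4) = 0 then
    ofBits (2 * n - 3 ∈ (g (y / (2 * n - 4) - 1)).fermions) (0 ∈ (g (y / (2 * n - 4))).fermions)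
      (g (y / (2 * n - 4) - 1)).bosons
  else if y % (2 * n - 4) = n - 2 then (g (y / (2 * n - 4))).charge else 0

theorem layersHalf_succ_mul (hn : 4 ≤ n) (a : ℕ) : layersHalf n g ((a + 1) * (2 * n - 4)) =
    ofBits (2 * n - 3 ∈ (g a).fermions) (0 ∈ (g (a + 1)).fermions) (g a).bosons := by
  rw [layersHalf, if_neg (Nat.mul_ne_zero a.succ_ne_zero (by omega)), Nat.mul_mod_left,
    if_pos rfl, Nat.mul_div_cancel _ (by omega), Nat.add_sub_cancel]

theorem layersHalf_mid (hn : 4 ≤ n) (a : ℕ) :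
    layersHalf n g (a * (2 * n - 4) + (n - 2)) = (g a).charge := by
  rw [layersHalf, if_neg (by omega), Nat.mul_add_mod', Nat.mod_eq_of_lt (by omega),
    if_neg (by omega), if_pos rfl, mul_add_div_period (by omega)]

theorem layersHalf_of_not_dvd (hn : 4 ≤ n) {y : ℕ} (hy : ¬ (n - 2) ∣ y) :
    layersHalf n g y = 0 := by
  rw [dvd_iff_mod_period hn, not_or] at hy
  rw [layersHalf, if_neg hy.1, if_neg hy.2, ite_self]

theorem mem_range_of_layersHalf_ne_zero (hn : 4 ≤ n) (hg : ∀ a, k ≤ a → g a = 0) {y : ℕ}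
    (hy : layersHalf n g y ≠ 0) : y ∈ range ((k + 1) * (2 * n - 4)) := by
  by_contra hlarge
  rw [mem_range, not_lt, ← Nat.le_div_iff_mul_le (by omega)] at hlarge
  refine hy ?_
  rw [layersHalf, hg (y / (2 * n - 4)) (by omega), hg (y / (2 * n - 4) - 1) (by omega)]
  simp [Layer.fermions_zero, Layer.charge_zero, Layer.bosons_zero, ofBits]

/-- The type of wall with the given layers. The fermion `0` of layer `0`, which is the parity of the
number of columns, cannot be prescribed. -/
noncomputable def ofLayers (hn : 4 ≤ n) (hg : ∀ a, k ≤ a → g a = 0) : Profile n where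
  full := {y ∈ range (k * (2 * n - 4)) | y % (2 * n - 4) + 1 ∈ (g (y / (2 * n - 4))).fermions}
  half := Finsupp.onFinset _ (layersHalf n g) fun _ => mem_range_of_layersHalf_ne_zero hn hg
  half_zero := rfl
  half_of_not_dvd _ := layersHalf_of_not_dvd hn

variable (hn : 4 ≤ n) (hg : ∀ a, k ≤ a → g a = 0)

theorem charge_layer_ofLayers (a : ℕ) : ((ofLayers hn hg).layer a).charge = (g a).charge :=
  layersHalf_mid hn a

theorem bosons_layer_ofLayers (a : ℕ) : ((ofLayers hn hg).layer a).bosons = (g a).bosons :=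
  (congrArg bosonPart (layersHalf_succ_mul hn a)).trans (bosonPart_ofBits _ _ _)

theorem zero_mem_layer_ofLayers_succ (a : ℕ) :
    0 ∈ ((ofLayers hn hg).layer (a + 1)).fermions ↔ 0 ∈ (g (a + 1)).fermions := by
  have hsign := signBit_ofBits (2 * n - 3 ∈ (g a).fermions) (0 ∈ (g (a + 1)).fermions) (g a).bosons
  rw [← layersHalf_succ_mul hn] at hsign
  rw [zero_mem_layer_succ _ hn]
  change 0 < layersHalf n g _ ↔ _
  unfold signBit at hsign
  by_cases hmem : 0 ∈ (g (a + 1)).fermions <;> simp_all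

theorem mem_layer_ofLayers (hsub : ∀ a, (g a).fermions ⊆ range (2 * n - 2)) {t : ℕ} (ht : t ≠ 0)
    (a : ℕ) : t ∈ ((ofLayers hn hg).layer a).fermions ↔ t ∈ (g a).fermions := by
  obtain ⟨b, rfl⟩ := Nat.exists_eq_succ_of_ne_zero ht
  obtain hb | rfl | hb := lt_trichotomy b (2 * n - 4)
  · rw [succ_mem_layer _ hb, ofLayers, mem_filter, Nat.mul_add_mod', Nat.mod_eq_of_lt hb,
      mul_add_div_period hb, and_iff_right_iff_imp]
    intro hmem
    have ha : a < k := by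
      by_contra hak
      rw [hg a (not_lt.1 hak)] at hmem
      exact notMem_empty _ hmem
    rw [mem_range, mul_comm a]
    exact Nat.mul_add_lt_mul_of_lt_of_lt ha hb
  · rw [show (2 * n - 4).succ = 2 * n - 3 by omega, last_mem_layer _ hn]
    change parityBit (layersHalf n g _) = 1 ↔ _
    rw [layersHalf_succ_mul hn, parityBit_ofBits]
    simp
  · refine iff_of_false (fun h => ?_) fun h => ?_
    · have := mem_range.1 (layer_fermions_subset _ a h)
      omega
    · have := mem_range.1 (hsub a h)
      omega

theorem layer_ofLayers_succ (hsub : ∀ a, (g a).fermions ⊆ range (2 * n - 2)) (a : ℕ) :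
    (ofLayers hn hg).layer (a + 1) = g (a + 1) := by
  refine Layer.ext (Finset.ext fun t => ?_) (charge_layer_ofLayers hn hg _)
    (bosons_layer_ofLayers hn hg _)
  obtain rfl | ht := eq_or_ne t 0
  · exact zero_mem_layer_ofLayers_succ hn hg a
  · exact mem_layer_ofLayers hn hg hsub ht (a + 1)

end OfLayers

/-- Layer `0` is determined by the other ones and by the parity of the total weight. -/
theorem exists_layer_eq (hn : 4 ≤ n) {g : ℕ → Layer} {k : ℕ} (hg : ∀ a, k ≤ a → g a = 0)
    (hsub : ∀ a, (g a).fermions ⊆ range (2 * n - 2))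
    (hweight : ∑ a ∈ range (k + 1), (g a).weight a = 2 * k) :
    ∃ P : Profile n, wt n P.wall 0 = k ∧ P.layer = g := by
  have hsucc := layer_ofLayers_succ hn hg hsub
  set P := ofLayers hn hg
  have hbound : P.IsBound ((k + 1 + 1) * (2 * n - 4)) := isBound_of_layer_eq_zero hn fun a ha => by
    obtain ⟨a, rfl⟩ := Nat.exists_eq_succ_of_ne_zero (by omega : a ≠ 0)
    exact (hsucc a).trans (hg _ (by omega))
  have hwt := two_mul_wt_zero_eq_sum_layers hn hbound
  have hweight' : ∑ a ∈ range (k + 1 + 1), (g a).weight a = 2 * k := by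
    rw [sum_range_succ, hweight, hg _ (Nat.le_succ k), Layer.weight_zero, add_zero]
  have hcharge := charge_layer_ofLayers hn hg 0
  have hzero : P.layer 0 = g 0 := by
    refine Layer.ext (eq_of_erase_eq (x := 0) (Finset.ext fun t => ?_) ?_) hcharge
      (bosons_layer_ofLayers hn hg 0)
    · rw [mem_erase, mem_erase]
      exact and_congr_right fun ht => mem_layer_ofLayers hn hg hsub ht 0
    · rw [sum_range_succ', sum_congr rfl fun a _ => by rw [hsucc], Layer.weight, hcharge] at hwt
      rw [sum_range_succ', Layer.weight] at hweight'
      omega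
  have hlayer : P.layer = g := funext fun a => by
    obtain _ | a := a
    · exact hzero
    · exact hsucc a
  rw [hlayer, hweight'] at hwt
  exact ⟨P, Nat.eq_of_mul_eq_mul_left two_pos hwt, hlayer⟩

end Profile

/-! ### Roots of unity -/

section RootsOfUnity

variable {n : ℕ}

theorem pow_rootExp_injOn {M : Type*} [CommMonoid M] {ξ : M} (hn : 4 ≤ n)
    (hξ : IsPrimitiveRoot ξ (2 * n - 1)) :
    Set.InjOn (fun t => ξ ^ rootExp n t) (range (2 * n - 2)) := by
  intro s hs t ht hst
  rw [mem_coe, mem_range] at hs ht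
  rw [(hξ.isOfFinOrder (by omega)).pow_eq_pow_iff_modEq, ← hξ.eq_orderOf] at hst
  unfold rootExp at hst
  have := hst.eq_of_abs_lt (by split_ifs <;> rw [abs_lt] <;> omega)
  split_ifs at this <;> omega

theorem pow_rootExp_ne_one {M : Type*} [CommMonoid M] {ξ : M}
    (hξ : IsPrimitiveRoot ξ (2 * n - 1)) {t : ℕ} (ht : t < 2 * n - 2) :
    ξ ^ rootExp n t ≠ 1 := by
  rw [Ne, hξ.pow_eq_one_iff_dvd]
  unfold rootExp
  split_ifs
  · exact Nat.not_dvd_of_lt_of_lt_mul_succ (k := 0) (by omega) (by omega)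
  · exact Nat.not_dvd_of_lt_of_lt_mul_succ (k := 1) (by omega) (by omega)

variable {R : Type*} [CommRing R]

/-- The elementary symmetric functions of the roots of unity other than `1`. -/
def rootEsymm (n : ℕ) (ξ : R) (i : ℕ) : R :=
  ∑ F ∈ powersetCard i (range (2 * n - 2)), ∏ t ∈ F, ξ ^ rootExp n t

open Polynomial in
theorem coeff_prod_one_add_root (n : ℕ) (ξ : R) (i : ℕ) :
    (∏ t ∈ range (2 * n - 2), (1 + C (ξ ^ rootExp n t) * X)).coeff i = rootEsymm n ξ i := by
  rw [prod_one_add, finsetSum_coeff, rootEsymm, powersetCard_eq_filter, sum_filter]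
  refine sum_congr rfl fun F _ => ?_
  rw [prod_mul_distrib, prod_const, ← map_prod, coeff_C_mul, coeff_X_pow, mul_ite, mul_one,
    mul_zero, if_congr eq_comm rfl rfl]

variable [IsDomain R] {ξ : R}

theorem nthRootsFinset_eq_insert_image [DecidableEq R] (hn : 4 ≤ n)
    (hξ : IsPrimitiveRoot ξ (2 * n - 1)) : Polynomial.nthRootsFinset (2 * n - 1) (1 : R) =
      insert 1 ((range (2 * n - 2)).image fun t => ξ ^ rootExp n t) := by
  have hone : 1 ∉ (range (2 * n - 2)).image fun t => ξ ^ rootExp n t := by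
    simpa using fun t ht => pow_rootExp_ne_one hξ ht
  refine (eq_of_subset_of_card_le (fun z hz => ?_) ?_).symm
  · rw [Polynomial.mem_nthRootsFinset (by omega)]
    obtain rfl | hz := mem_insert.1 hz
    · rw [one_pow]
    · obtain ⟨t, -, rfl⟩ := mem_image.1 hz
      rw [pow_right_comm, hξ.pow_eq_one, one_pow]
  · rw [hξ.card_nthRootsFinset, card_insert_of_notMem hone,
      card_image_of_injOn (pow_rootExp_injOn hn hξ), card_range]
    omega

open Polynomial in
theorem prod_one_add_root_mul (hn : 4 ≤ n) (hξ : IsPrimitiveRoot ξ (2 * n - 1)) :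
    (∏ t ∈ range (2 * n - 2), (1 + C (ξ ^ rootExp n t) * X)) * (1 + X) =
      1 + X ^ (2 * n - 1) := by
  classical
  have hζ : IsPrimitiveRoot (C ξ) (2 * n - 1) := hξ.map_of_injective C_injective
  have hprod := hζ.pow_add_pow_eq_prod_add_mul 1 X ⟨n - 1, by omega⟩
  rw [one_pow, nthRootsFinset_eq_insert_image hn hζ, prod_insert,
    prod_image (pow_rootExp_injOn hn hζ), one_mul] at hprod
  · rw [mul_comm, hprod]
    simp only [map_pow]
  · simpa using fun t ht => pow_rootExp_ne_one hζ ht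

theorem rootEsymm_add (hn : 4 ≤ n) (hξ : IsPrimitiveRoot ξ (2 * n - 1)) (i : ℕ) :
    rootEsymm n ξ (i + 1) + rootEsymm n ξ i = if i = 2 * n - 2 then 1 else 0 := by
  have hcoeff := congrArg (fun p => p.coeff (i + 1)) (prod_one_add_root_mul hn hξ)
  simp only [mul_add, mul_one, Polynomial.coeff_add, Polynomial.coeff_mul_X,
    coeff_prod_one_add_root, Polynomial.coeff_one, Polynomial.coeff_X_pow, i.succ_ne_zero,
    if_false, zero_add] at hcoeff
  rw [hcoeff]
  exact if_congr (by omega) rfl rfl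

/-- In terms of generating functions: multiplication of `(1 + X ^ (2 * n - 1)) / (1 + X)` by
`∑ D : ℤ, X ^ |D| = (1 + X) / (1 - X)` gives `(1 + X ^ (2 * n - 1)) / (1 - X)`. -/
theorem two_mul_sum_rootEsymm_sub (hn : 4 ≤ n) (hξ : IsPrimitiveRoot ξ (2 * n - 1)) (N : ℕ) :
    2 * ∑ i ∈ range (N + 1), rootEsymm n ξ i - rootEsymm n ξ N =
      if N ≤ 2 * n - 2 then 1 else 2 := by
  induction N with
  | zero =>
    rw [zero_add, sum_range_one, if_pos (Nat.zero_le _), two_mul, add_sub_cancel_right, rootEsymm,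
      powersetCard_zero, sum_singleton, prod_empty]
  | succ N ih =>
    have hstep : (if N + 1 ≤ 2 * n - 2 then 1 else 2 : R) =
        (if N ≤ 2 * n - 2 then 1 else 2) + if N = 2 * n - 2 then 1 else 0 := by
      split_ifs <;> first | omega | norm_num
    rw [hstep, ← ih, ← rootEsymm_add hn hξ, sum_range_succ _ (N + 1)]
    ring

end RootsOfUnity

section LayersOfType

variable {n N j : ℕ}

/-- The layers with `j` bosons for which the number of fermions plus the absolute value of the
charge is `N`. These data determine the weight of a layer. -/
noncomputable def layersOfType (n N j : ℕ) : Finset Layer :=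
  ((Icc (-N : ℤ) N).sigma fun D => powersetCard (N - D.natAbs) (range (2 * n - 2))).map
    ⟨fun x => ⟨x.2, x.1, j⟩, fun _ _ h => Sigma.ext (congrArg Layer.charge h)
      (heq_of_eq (congrArg Layer.fermions h))⟩

theorem mem_layersOfType {x : Layer} : x ∈ layersOfType n N j ↔
    x.fermions ⊆ range (2 * n - 2) ∧ #x.fermions + x.charge.natAbs = N ∧ x.bosons = j := by
  constructor
  · intro h
    obtain ⟨⟨D, F⟩, hDF, rfl⟩ := mem_map.1 h
    obtain ⟨hD, hF⟩ := mem_sigma.1 hDF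
    obtain ⟨hsub, hcard⟩ := mem_powersetCard.1 hF
    replace hD : -(N : ℤ) ≤ D ∧ D ≤ N := mem_Icc.1 hD
    have hle : D.natAbs ≤ N := by omega
    exact ⟨hsub, (congrArg (· + D.natAbs) hcard).trans (Nat.sub_add_cancel hle), rfl⟩
  · rintro ⟨hsub, hN, rfl⟩
    have hcharge : x.charge ∈ Icc (-N : ℤ) N := mem_Icc.2 (by omega)
    exact mem_map.2 ⟨⟨x.charge, x.fermions⟩, mem_sigma.2 ⟨hcharge,
      mem_powersetCard.2 ⟨hsub, Nat.eq_sub_of_add_eq hN⟩⟩, rfl⟩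

theorem sum_layersOfType {R : Type*} [CommRing R] [IsDomain R] {ξ : R} (hn : 4 ≤ n)
    (hξ : IsPrimitiveRoot ξ (2 * n - 1)) (N j : ℕ) :
    ∑ x ∈ layersOfType n N j, ∏ t ∈ x.fermions, ξ ^ rootExp n t =
      if N ≤ 2 * n - 2 then 1 else 2 := by
  have heven : Function.Even fun D : ℤ => rootEsymm n ξ (N - D.natAbs) := fun D => by
    simp only [Int.natAbs_neg]
  rw [← two_mul_sum_rootEsymm_sub hn hξ, layersOfType, sum_map, sum_sigma]
  refine (sum_Icc_of_even_eq_range heven N).trans ?_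
  have hreflect := sum_range_reflect (rootEsymm n ξ) (N + 1)
  simp only [Nat.add_sub_cancel] at hreflect
  simp [hreflect, two_mul]

theorem eq_Ico_of_forall_succ_mem {m : ℕ} {F : Finset ℕ} (hF : F ⊆ range m)
    (hsucc : ∀ t ∈ F, t + 1 < m → t + 1 ∈ F) : F = Ico (m - #F) m := by
  have hIco : ∀ t ∈ F, Ico t m ⊆ F := fun t ht s hs => by
    obtain ⟨hts, hsm⟩ := mem_Ico.1 hs
    induction s, hts using Nat.le_induction with
    | base => exact ht
    | succ s hts ih => exact hsucc s (ih (mem_Ico.2 ⟨hts, by omega⟩) (by omega)) hsm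
  refine eq_of_subset_of_card_le (fun t ht => ?_) (by rw [Nat.card_Ico]; omega)
  have hcard := card_le_card (hIco t ht)
  have ht' := mem_range.1 (hF ht)
  rw [Nat.card_Ico] at hcard
  exact mem_Ico.2 ⟨by omega, ht'⟩

theorem Layer.isAllowed_iff (hn : 4 ≤ n) {x : Layer} (hx : x.fermions ⊆ range (2 * n - 2)) :
    x.IsAllowed n ↔ x.fermions = Ico (2 * n - 2 - #x.fermions) (2 * n - 2) ∧
      (x.charge ≠ 0 → #x.fermions = n - 1 ∧ n - 1 < x.charge.natAbs) := by
  have hcard := card_le_card hx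
  rw [card_range] at hcard
  rw [IsAllowed]
  refine ⟨fun ⟨hsucc, hmid, hcharge⟩ => ?_, fun ⟨hIco, hcharge⟩ => ?_⟩
  · have hIco := eq_Ico_of_forall_succ_mem hx hsucc
    refine ⟨hIco, fun hD => ?_⟩
    have hmid' : n - 2 ∉ x.fermions := fun h => hD (hmid h)
    have hcharge' := hcharge hD
    rw [hIco, mem_Ico] at hmid' hcharge'
    omega
  · rw [hIco]
    simp only [mem_Ico]
    refine ⟨fun t ht hlt => by omega, fun ht => ?_, fun hD => ?_⟩
    · by_contra hD
      have := hcharge hD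
      omega
    · have := hcharge hD
      omega

theorem mem_layersOfType_isAllowed_iff (hn : 4 ≤ n) {x : Layer} :
    x ∈ layersOfType n N j ∧ x.IsAllowed n ↔ x.bosons = j ∧
      (N ≤ 2 * n - 2 ∧ x.fermions = Ico (2 * n - 2 - N) (2 * n - 2) ∧ x.charge = 0 ∨
        2 * n - 2 < N ∧ x.fermions = Ico (n - 1) (2 * n - 2) ∧
          (x.charge = (N - (n - 1) : ℕ) ∨ x.charge = -(N - (n - 1) : ℕ))) := by
  rw [mem_layersOfType]
  constructor
  · rintro ⟨⟨hsub, hN, hj⟩, hx⟩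
    have hle := card_le_card hsub
    rw [card_range] at hle
    obtain ⟨hIco, hcharge⟩ := (Layer.isAllowed_iff hn hsub).1 hx
    refine ⟨hj, ?_⟩
    obtain hD | hD := eq_or_ne x.charge 0
    · obtain rfl : #x.fermions = N := by rwa [hD] at hN
      exact Or.inl ⟨hle, hIco, hD⟩
    · obtain ⟨hF, hlt⟩ := hcharge hD
      rw [hF, show 2 * n - 2 - (n - 1) = n - 1 by omega] at hIco
      exact Or.inr ⟨by omega, hIco, by omega⟩
  · rintro ⟨hj, ⟨hN, hIco, hD⟩ | ⟨hN, hIco, hD⟩⟩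
    · have hcard : #x.fermions = N := by rw [hIco, Nat.card_Ico]; omega
      have hsub : x.fermions ⊆ range (2 * n - 2) := by
        rw [hIco, range_eq_Ico]
        exact Ico_subset_Ico_left (Nat.zero_le _)
      exact ⟨⟨hsub, by omega, hj⟩,
        (Layer.isAllowed_iff hn hsub).2 ⟨by rw [hcard, hIco], fun h => absurd hD h⟩⟩
    · have hcard : #x.fermions = n - 1 := by rw [hIco, Nat.card_Ico]; omega
      have hsub : x.fermions ⊆ range (2 * n - 2) := by
        rw [hIco, range_eq_Ico]
        exact Ico_subset_Ico_left (Nat.zero_le _)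
      refine ⟨⟨hsub, by omega, hj⟩,
        (Layer.isAllowed_iff hn hsub).2 ⟨?_, fun _ => ⟨hcard, by omega⟩⟩⟩
      rw [hcard, hIco, show 2 * n - 2 - (n - 1) = n - 1 by omega]

theorem card_isAllowed (hn : 4 ≤ n) (N j : ℕ) :
    #{x ∈ layersOfType n N j | x.IsAllowed n} = if N ≤ 2 * n - 2 then 1 else 2 := by
  split_ifs with hN
  · rw [card_eq_one]
    refine ⟨⟨Ico (2 * n - 2 - N) (2 * n - 2), 0, j⟩, ?_⟩
    ext x
    rw [mem_filter, mem_layersOfType_isAllowed_iff hn, mem_singleton, Layer.ext_iff]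
    have := hN.not_gt
    tauto
  · rw [card_eq_two]
    refine ⟨⟨Ico (n - 1) (2 * n - 2), (N - (n - 1) : ℕ), j⟩,
      ⟨Ico (n - 1) (2 * n - 2), -(N - (n - 1) : ℕ), j⟩, ?_, ?_⟩
    · rw [Ne, Layer.mk.injEq]
      omega
    · ext x
      rw [mem_filter, mem_layersOfType_isAllowed_iff hn, mem_insert, mem_singleton, Layer.ext_iff,
        Layer.ext_iff]
      have := not_le.1 hN
      tauto

end LayersOfType

section LayerSeqs

variable {n k : ℕ}

/-- The possible types of the first `k + 1` layers of a wall with `0`-weight `k`: the number of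
fermions plus the absolute value of the charge, and the number of bosons. -/
def layerTypes (k : ℕ) : Finset (Fin (k + 1) → ℕ × ℕ) :=
  {T ∈ Fintype.piFinset fun _ => range (2 * k + 1) ×ˢ range (2 * k + 1) |
    ∑ a : Fin (k + 1), ((2 * (a : ℕ) + 1) * (T a).1 + 4 * ((a : ℕ) + 1) * (T a).2) = 2 * k}

/-- The sequences of layers with total weight `2 * k`. -/
noncomputable def layerSeqs (n k : ℕ) : Finset (Fin (k + 1) → Layer) :=
  (layerTypes k).biUnion fun T => Fintype.piFinset fun a => layersOfType n (T a).1 (T a).2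

theorem mem_layerSeqs {g : Fin (k + 1) → Layer} : g ∈ layerSeqs n k ↔
    (∀ a, (g a).fermions ⊆ range (2 * n - 2)) ∧ ∑ a, (g a).weight a = 2 * k := by
  simp only [layerSeqs, layerTypes, mem_biUnion, mem_filter, Fintype.mem_piFinset,
    mem_layersOfType, mem_product, mem_range]
  constructor
  · rintro ⟨T, ⟨-, hT⟩, hg⟩
    refine ⟨fun a => (hg a).1, hT ▸ sum_congr rfl fun a _ => ?_⟩
    rw [Layer.weight, (hg a).2.1, (hg a).2.2]
  · rintro ⟨hsub, hweight⟩
    refine ⟨fun a => (#(g a).fermions + (g a).charge.natAbs, (g a).bosons), ⟨fun a => ?_, hweight⟩,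
      fun a => ⟨hsub a, rfl, rfl⟩⟩
    have hle : (g a).weight a ≤ 2 * k := by
      rw [← hweight]
      exact single_le_sum (f := fun a : Fin (k + 1) => (g a).weight a) (fun _ _ => Nat.zero_le _)
        (mem_univ a)
    have hfirst := Nat.le_mul_of_pos_left (#(g a).fermions + (g a).charge.natAbs)
      (by omega : 0 < 2 * (a : ℕ) + 1)
    have hsecond := Nat.le_mul_of_pos_left (g a).bosons (by omega : 0 < 4 * ((a : ℕ) + 1))
    unfold Layer.weight at hle
    simp only
    omega

theorem sum_layerSeqs_prod {R : Type*} [CommSemiring R] (w : Layer → R) :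
    ∑ g ∈ layerSeqs n k, ∏ a, w (g a) =
      ∑ T ∈ layerTypes k, ∏ a, ∑ x ∈ layersOfType n (T a).1 (T a).2, w x := by
  rw [layerSeqs, sum_biUnion]
  · exact sum_congr rfl fun T _ => (prod_univ_sum _ fun _ => w).symm
  · refine fun T _ T' _ hne => disjoint_left.2 fun g hg hg' => hne (funext fun a => ?_)
    obtain ⟨-, hN, hj⟩ := mem_layersOfType.1 (Fintype.mem_piFinset.1 hg a)
    obtain ⟨-, hN', hj'⟩ := mem_layersOfType.1 (Fintype.mem_piFinset.1 hg' a)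
    exact Prod.ext (hN.symm.trans hN') (hj.symm.trans hj')

theorem sum_layerSeqs_eq_card {R : Type*} [CommRing R] [IsDomain R] {ξ : R} (hn : 4 ≤ n)
    (hξ : IsPrimitiveRoot ξ (2 * n - 1)) (k : ℕ) :
    ∑ g ∈ layerSeqs n k, ∏ a, ∏ t ∈ (g a).fermions, ξ ^ rootExp n t =
      #{g ∈ layerSeqs n k | ∀ a, (g a).IsAllowed n} := by
  calc ∑ g ∈ layerSeqs n k, ∏ a, ∏ t ∈ (g a).fermions, ξ ^ rootExp n t
      = ∑ T ∈ layerTypes k, ∏ a, ∑ x ∈ layersOfType n (T a).1 (T a).2,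
          if x.IsAllowed n then 1 else 0 := by
        rw [sum_layerSeqs_prod fun x => ∏ t ∈ x.fermions, ξ ^ rootExp n t]
        refine sum_congr rfl fun T _ => prod_congr rfl fun a _ => ?_
        rw [sum_layersOfType hn hξ, sum_boole, card_isAllowed hn, Nat.cast_ite, Nat.cast_one,
          Nat.cast_ofNat]
    _ = ∑ g ∈ layerSeqs n k, ∏ a, if (g a).IsAllowed n then 1 else 0 :=
        (sum_layerSeqs_prod fun x => if x.IsAllowed n then (1 : R) else 0).symm
    _ = _ := by simp only [prod_boole, mem_univ, forall_const, sum_boole]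

end LayerSeqs

/-! ### Generating series -/

section Walls

variable {n k : ℕ}

/-- The first `k + 1` layers of a wall. The other ones are empty if the wall has `0`-weight `k`. -/
noncomputable def YoungWall.layers (k : ℕ) (Y : YoungWall n) : Fin (k + 1) → Layer :=
  fun a => ((wallEquiv n).symm Y).layer a

theorem wall_wallEquiv_symm (Y : YoungWall n) : ((wallEquiv n).symm Y).wall = Y.1 :=
  congrArg Subtype.val ((wallEquiv n).apply_symm_apply Y)

theorem YoungWall.layers_mem (hn : 4 ≤ n) {Y : YoungWall n} (hY : wt n Y.1 0 = k) :
    Y.layers k ∈ layerSeqs n k := by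
  have hbound := ((wallEquiv n).symm Y).isBound_wt_zero hn
  have hweight := Profile.two_mul_wt_zero_eq_sum_layers hn hbound
  rw [wall_wallEquiv_symm, hY, sum_range] at hweight
  exact mem_layerSeqs.2 ⟨fun a => Profile.layer_fermions_subset _ a, hweight.symm⟩

theorem YoungWall.layers_injOn (hn : 4 ≤ n) (k : ℕ) :
    Set.InjOn (layers k) {Y : YoungWall n | wt n Y.1 0 = k} := by
  intro Y hY Y' hY' hlayers
  refine (wallEquiv n).symm.injective (Profile.layer_injective hn (funext fun a => ?_))
  obtain ha | ha := lt_or_ge a (k + 1)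
  · exact congrFun hlayers ⟨a, ha⟩
  · rw [Set.mem_ofPred_eq, ← wall_wallEquiv_symm] at hY hY'
    rw [Profile.layer_eq_zero hn (by omega), Profile.layer_eq_zero hn (by omega)]

theorem YoungWall.layers_surjOn (hn : 4 ≤ n) (k : ℕ) :
    Set.SurjOn (layers k) {Y : YoungWall n | wt n Y.1 0 = k} (layerSeqs n k) := by
  intro g hg
  obtain ⟨hsub, hweight⟩ := mem_layerSeqs.1 (mem_coe.1 hg)
  set G : ℕ → Layer := fun a => if h : a < k + 1 then g ⟨a, h⟩ else 0
  have hG : ∀ a : Fin (k + 1), G a = g a := fun a => dif_pos a.2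
  have hG_zero : ∀ a, k + 1 ≤ a → G a = 0 := fun a ha => dif_neg ha.not_gt
  have hlast : G k = 0 := by
    refine Layer.eq_zero_of_weight_le (a := k) ?_
    rw [← hweight, show G k = g (Fin.last k) from hG (Fin.last k)]
    exact single_le_sum (f := fun a : Fin (k + 1) => (g a).weight a) (fun _ _ => Nat.zero_le _)
      (mem_univ (Fin.last k))
  have hG_sub : ∀ a, (G a).fermions ⊆ range (2 * n - 2) := fun a => by
    obtain ha | ha := lt_or_ge a (k + 1)
    · exact (hG ⟨a, ha⟩).symm ▸ hsub _
    · rw [hG_zero a ha]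
      exact empty_subset _
  have hG_weight : ∑ a ∈ range (k + 1), (G a).weight a = 2 * k := by
    rw [sum_range, ← hweight]
    exact sum_congr rfl fun a _ => by rw [hG]
  obtain ⟨P, hP, hlayer⟩ := Profile.exists_layer_eq hn
    (fun a ha => ha.eq_or_lt.elim (fun h => h ▸ hlast) (hG_zero a)) hG_sub hG_weight
  refine ⟨wallEquiv n P, hP, funext fun a => ?_⟩
  rw [layers, Equiv.symm_apply_apply, hlayer, hG]

theorem YoungWall.layers_bijOn (hn : 4 ≤ n) (k : ℕ) :
    Set.BijOn (layers k) {Y : YoungWall n | wt n Y.1 0 = k} (layerSeqs n k) :=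
  ⟨fun _ hY => layers_mem hn hY, layers_injOn hn k, layers_surjOn hn k⟩

theorem finite_wt_zero_eq (hn : 4 ≤ n) (k : ℕ) : {Y : YoungWall n | wt n Y.1 0 = k}.Finite :=
  (YoungWall.layers_bijOn hn k).finite_iff_finite.2 (layerSeqs n k).finite_toSet

theorem mem_toFinset_wt_zero_eq (hn : 4 ≤ n) {Y : YoungWall n} :
    Y ∈ (finite_wt_zero_eq hn k).toFinset ↔ wt n Y.1 0 = k :=
  Set.Finite.mem_toFinset _

theorem YoungWall.isDistinguished_iff (hn : 4 ≤ n) {Y : YoungWall n} (hY : wt n Y.1 0 = k) :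
    IsDistinguished n Y.1 ↔ ∀ a, (Y.layers k a).IsAllowed n := by
  rw [← wall_wallEquiv_symm] at hY ⊢
  rw [Profile.isDistinguished_iff_layers _ hn]
  refine ⟨fun h a => h a, fun h a => ?_⟩
  obtain ha | ha := lt_or_ge a (k + 1)
  · exact h ⟨a, ha⟩
  · rw [Profile.layer_eq_zero hn (by omega)]
    exact Layer.isAllowed_zero n

theorem YoungWall.pow_whites {M : Type*} [CommMonoid M] {ξ : M} (hn : 4 ≤ n)
    (hξ : ξ ^ (2 * n - 1) = 1) {Y : YoungWall n} (hY : wt n Y.1 0 = k) :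
    ξ ^ (whites Y.1 + wt n Y.1 0) = ∏ a, ∏ t ∈ (Y.layers k a).fermions, ξ ^ rootExp n t := by
  have hmod := Profile.whites_add_wt_zero_modEq hn (((wallEquiv n).symm Y).isBound_wt_zero hn)
  rw [wall_wallEquiv_symm, hY, sum_range] at hmod
  rw [hY, pow_eq_pow_of_modEq hmod hξ]
  simp only [prod_pow_eq_pow_sum, layers]

theorem sum_pow_whites {R : Type*} [CommRing R] [IsDomain R] {ξ : R} (hn : 4 ≤ n)
    (hξ : IsPrimitiveRoot ξ (2 * n - 1)) (k : ℕ) :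
    ∑ Y ∈ (finite_wt_zero_eq hn k).toFinset, ξ ^ (whites Y.1 + wt n Y.1 0) =
      Nat.card {Y : YoungWall n // IsDistinguished n Y.1 ∧ wt n Y.1 0 = k} := by
  have hbij := YoungWall.layers_bijOn hn k
  have hcard : Nat.card {Y : YoungWall n // IsDistinguished n Y.1 ∧ wt n Y.1 0 = k} =
      #{g ∈ layerSeqs n k | ∀ a, (g a).IsAllowed n} := by
    rw [← Nat.card_eq_finsetCard]
    refine Nat.card_congr (Set.BijOn.equiv (YoungWall.layers k)
      (s := {Y | IsDistinguished n Y.1 ∧ wt n Y.1 0 = k})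
      (t := {g | g ∈ ({g ∈ layerSeqs n k | ∀ a, (g a).IsAllowed n} : Finset _)})
      ⟨fun Y hY => ?_, hbij.injOn.mono fun Y hY => hY.2, fun g hg => ?_⟩)
    · exact mem_filter.2 ⟨hbij.mapsTo hY.2, (YoungWall.isDistinguished_iff hn hY.2).1 hY.1⟩
    · obtain ⟨hg, hallowed⟩ := mem_filter.1 hg
      obtain ⟨Y, hY, rfl⟩ := hbij.surjOn hg
      exact ⟨Y, ⟨(YoungWall.isDistinguished_iff hn hY).2 hallowed, hY⟩, rfl⟩
  rw [hcard, ← sum_layerSeqs_eq_card hn hξ]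
  refine sum_nbij (YoungWall.layers k) ?_ ?_ ?_ ?_
  · exact fun Y hY => YoungWall.layers_mem hn ((mem_toFinset_wt_zero_eq hn).1 hY)
  · rw [Set.Finite.coe_toFinset]
    exact hbij.injOn
  · rw [Set.Finite.coe_toFinset]
    exact hbij.surjOn
  · exact fun Y hY =>
      YoungWall.pow_whites hn hξ.pow_eq_one ((mem_toFinset_wt_zero_eq hn).1 hY)

end Walls

section Substitution

variable {n : ℕ}

theorem sum_wtVec (hn : 4 ≤ n) (Y : YoungWall n) : ∑ i, wtVec n Y.1 i = whites Y.1 := by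
  rw [← sum_wt hn Y.2, sum_range]
  rfl

open PowerSeries in
theorem coeff_substitution {R : Type*} [CommSemiring R] (c ξ : R) (v : Fin (n + 1) →₀ ℕ) (k : ℕ) :
    coeff k (C c * v.prod fun i e => (if i = 0 then C (ξ ^ 2) * X else C ξ) ^ e) =
      if v 0 = k then c * ξ ^ ((∑ i, v i) + v 0) else 0 := by
  have hmonomial : C c * v.prod (fun i e => (if i = 0 then C (ξ ^ 2) * X else C ξ) ^ e) =
      C (c * ξ ^ ((∑ i, v i) + v 0)) * X ^ v 0 := by
    rw [Finsupp.prod_fintype _ _ (fun _ => pow_zero _), Fin.prod_univ_succ, Fin.sum_univ_succ]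
    simp only [if_true, Fin.succ_ne_zero, if_false, prod_pow_eq_pow_sum, map_mul, map_pow]
    ring
  rw [hmonomial, coeff_C_mul, coeff_X_pow, mul_ite, mul_one, mul_zero, if_congr eq_comm rfl rfl]

theorem coeff_wallSeries [DecidableEq (Fin (n + 1) →₀ ℕ)] {k : ℕ} (hn : 4 ≤ n)
    {v : Fin (n + 1) →₀ ℕ} (hv : v 0 = k) : MvPowerSeries.coeff v (wallSeries n) =
      #{Y ∈ (finite_wt_zero_eq hn k).toFinset | wtVec n Y.1 = v} := by
  change ((Nat.card {Y : YoungWall n // wtVec n Y.1 = v} : ℕ) : ℂ) = _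
  rw [← Nat.card_eq_finsetCard]
  congr 1
  refine Nat.card_congr (Equiv.subtypeEquivRight fun Y => ?_)
  rw [mem_filter, mem_toFinset_wt_zero_eq hn]
  exact ⟨fun h => ⟨by rw [← hv, ← h]; rfl, h⟩, And.right⟩

open scoped PowerSeries.WithPiTopology in
theorem hasSpecialization_wallSeries (hn : 4 ≤ n) {ξ : ℂ} (hξ : IsPrimitiveRoot ξ (2 * n - 1)) :
    HasSpecialization (wallSeries n)
      (fun i : Fin (n + 1) =>
        if i = 0 then PowerSeries.C (ξ ^ 2) * PowerSeries.X else PowerSeries.C ξ)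
      (distinguishedSeries n) := by
  classical
  rw [HasSpecialization, PowerSeries.WithPiTopology.hasSum_iff_hasSum_coeff]
  intro k
  simp only [coeff_substitution]
  set W := (finite_wt_zero_eq hn k).toFinset with hW
  have hzero : ∀ Y ∈ W, wtVec n Y.1 0 = k := fun Y hY => (mem_toFinset_wt_zero_eq hn).1 hY
  have hsum : PowerSeries.coeff k (distinguishedSeries n) = ∑ v ∈ W.image fun Y => wtVec n Y.1,
      if v 0 = k then MvPowerSeries.coeff v (wallSeries n) * ξ ^ ((∑ i, v i) + v 0) else 0 := by
    rw [distinguishedSeries, PowerSeries.coeff_mk, ← sum_pow_whites hn hξ k,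
      ← sum_fiberwise_of_maps_to fun Y hY => mem_image_of_mem (fun Y => wtVec n Y.1) hY]
    refine sum_congr rfl fun v hv => ?_
    obtain ⟨Y, hY, rfl⟩ := mem_image.1 hv
    rw [if_pos (hzero Y hY), coeff_wallSeries hn (hzero Y hY), ← nsmul_eq_mul]
    refine sum_eq_card_nsmul fun Y' hY' => ?_
    rw [← (mem_filter.1 hY').2, sum_wtVec hn]
    rfl
  rw [hsum]
  refine hasSum_sum_of_ne_finset_zero fun v hv => ?_
  split_ifs with hvk
  · rw [coeff_wallSeries hn hvk, ← hW, filter_false_of_mem, card_empty, Nat.cast_zero, zero_mul]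
    exact fun Y hY hYv => hv (mem_image.2 ⟨Y, hY, hYv⟩)
  · rfl

end Substitution

end DWall

theorem theorem9p8 (n : ℕ) (hn : 4 ≤ n) (ξ : ℂ) (hξ : IsPrimitiveRoot ξ (2 * n - 1)) :
    (∀ k : ℕ, {Y : DWall.YoungWall n | DWall.wt n Y.1 0 = k}.Finite) ∧
    DWall.HasSpecialization (DWall.wallSeries n)
      (fun i : Fin (n + 1) =>
        if i = 0 then PowerSeries.C (ξ ^ 2) * PowerSeries.X else PowerSeries.C ξ)
      (DWall.distinguishedSeries n) :=
  ⟨DWall.finite_wt_zero_eq hn, DWall.hasSpecialization_wallSeries hn hξ⟩
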